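/- Let $N\ge 1$, $s\in(0,1)$, and let $a:\mathbb{R}^N\times\mathbb{R}^N\times(0,\infty)\to[0,\infty)$. Put $g(x,y,t)=a(x,y,t)\,t$ for $t>0$, $g(x,y,0)=0$, and $$G_{x,y}(t)=G(x,y,t)=\int_0^t g(x,y,\tau)\,d\tau\qquad(x,y\in\mathbb{R}^N,\ t\ge 0),\qquad \widehat G_x(t)=G_{x,x}(t).$$ Assume that $G$ is a Carathéodory function (measurable in $(x,y)$ for each $t\ge 0$ and continuous in $t$ for each $(x,y)$), and that: (g1) $\lim_{t\to 0^+}a(x,y,t)t=0$ and $\lim_{t\to+\infty}a(x,y,t)t=+\infty$ for all $x,y\in\mathbb{R}^N$; (g2) $t\mapsto a(x,y,t)$ is continuous on $(0,\infty)$ for all $x,y$; (g3) $t\mapsto a(x,y,t)t$ is increasing (in the wide sense) on $(0,\infty)$ for all $x,y$; (g4) there are constants $g^-,g^+$ with $1<g^-\le \dfrac{a(x,y,t)t^2}{G_{x,y}(t)}\le g^+<+\infty$ for all $x,y\in\mathbb{R}^N$ and $t>0$; (H1) for every $c>0$ and every compact $A\subset\mathbb{R}^N$, $\int_{A\times A}G_{x,y}(c)\,dx\,dy<\infty$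 and $\int_A\widehat G_x(c)\,dx<\infty$; (H2) $G(x-z,y-z,t)=G(x,y,t)$ for all $x,y,z\in\mathbb{R}^N$ and $t\ge 0$; ($\mathcal{B}_f$) there are $C_1,C_2>0$ with $C_1\le G_{x,y}(1)\le C_2$ for all $x,y\in\mathbb{R}^N$. For measurable $u:\mathbb{R}^N\to\mathbb{R}$ put $$J(u)=\int_{\mathbb{R}^N}\widehat G_x(|u(x)|)\,dx,\qquad J_s(u)=\int_{\mathbb{R}^N}\int_{\mathbb{R}^N}G_{x,y}\!\left(\frac{|u(x)-u(y)|}{|x-y|^s}\right)\frac{dx\,dy}{|x-y|^N},$$ let $W^{s,G_{x,y}}(\mathbb{R}^N)$ be the space of measurable $u$ with $J(\lambda u)<\infty$ for some $\lambda>0$ and $J_s(\lambda u)<\infty$ for some $\lambda>0$, with the norm $$\|u\|=\inf\{\lambda>0: J(u/\lambda)\le 1\}+\inf\{\lambda>0: J_s(u/\lambda)\le 1\},$$ and let $$W_0^{s,G_{x,y}}(\Omega)=\{u\in W^{s,G_{x,y}}(\mathbb{R}^N): u=0\text{ a.e. in }\mathbb{R}^N\setminus\Omega\}.$$ Let $\Omega\subseteq\mathbb{R}^N$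 be a hypograph, that is, the image under a rigid motion of $\{(x',x_N)\in\mathbb{R}^{N-1}\times\mathbb{R}: x_N<\xi(x')\}$ for some continuous $\xi:\mathbb{R}^{N-1}\to\mathbb{R}$. Then $C_0^\infty(\Omega)$, the set of $C^\infty$ functions on $\mathbb{R}^N$ whose support is compact and contained in $\Omega$, is contained and dense in $W_0^{s,G_{x,y}}(\Omega)$: for every $u\in W_0^{s,G_{x,y}}(\Omega)$ and every $\varepsilon>0$ there is $\varphi\in C_0^\infty(\Omega)$ with $\|u-\varphi\|<\varepsilon$. -/

import Mathlib

open MeasureTheory Set Filter Topology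
open scoped ENNReal ContDiff

noncomputable section

namespace FracMusielak

/-- `ℝ^N` with its Euclidean norm. -/
abbrev E (N : ℕ) := EuclideanSpace ℝ (Fin N)

/-! ### The function `G` and its assumptions

A function `a : ℝ^N × ℝ^N × (0, ∞) → [0, ∞)` is represented by a function
`E N → E N → ℝ → ℝ`, of which only the values at `t > 0` matter. -/

/-- `g(x, y, t) = a(x, y, t) t` if `t ≠ 0`, and `g(x, y, 0) = 0`. -/
def gFun {N : ℕ} (a : E N → E N → ℝ → ℝ) (x y : E N) (t : ℝ) : ℝ :=
  if t = 0 then 0 else a x y t * t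

/-- `G(x, y, t) = ∫₀ᵗ g(x, y, τ) dτ`. -/
def GFun {N : ℕ} (a : E N → E N → ℝ → ℝ) (x y : E N) (t : ℝ) : ℝ :=
  ∫ τ in (0 : ℝ)..t, gFun a x y τ

/-- Carathéodory function on `ℝ^N × ℝ^N × [0, ∞)`: (Lebesgue) measurable in `(x, y)` for each
`t ≥ 0` and continuous in `t` for each `(x, y)`. -/
def IsCaratheodory {N : ℕ} (G : E N → E N → ℝ → ℝ) : Prop :=
  (∀ t : ℝ, 0 ≤ t → AEMeasurable (fun p : E N × E N => G p.1 p.2 t) volume) ∧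
    ∀ x y : E N, ContinuousOn (G x y) (Ici 0)

/-- `a(x, y, t) t → 0` as `t → 0⁺` and `a(x, y, t) t → ∞` as `t → ∞`. -/
def CondG1 {N : ℕ} (a : E N → E N → ℝ → ℝ) : Prop :=
  ∀ x y : E N, Tendsto (fun t : ℝ => a x y t * t) (𝓝[>] 0) (𝓝 0) ∧
    Tendsto (fun t : ℝ => a x y t * t) atTop atTop

/-- `t ↦ a(x, y, t)` is continuous on `(0, ∞)`. -/
def CondG2 {N : ℕ} (a : E N → E N → ℝ → ℝ) : Prop :=
  ∀ x y : E N, ContinuousOn (a x y) (Ioi 0)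

/-- `t ↦ a(x, y, t) t` is increasing (nondecreasing) on `(0, ∞)`. -/
def CondG3 {N : ℕ} (a : E N → E N → ℝ → ℝ) : Prop :=
  ∀ x y : E N, MonotoneOn (fun t : ℝ => a x y t * t) (Ioi 0)

/-- `1 < g⁻ ≤ a(x, y, t) t² / G(x, y, t) ≤ g⁺ < ∞` with constants uniform in `x`, `y`, `t > 0`. -/
def CondG4 {N : ℕ} (a : E N → E N → ℝ → ℝ) : Prop :=
  ∃ gm gp : ℝ, 1 < gm ∧ ∀ x y : E N, ∀ t : ℝ, 0 < t →
    gm ≤ a x y t * t ^ 2 / GFun a x y t ∧ a x y t * t ^ 2 / GFun a x y t ≤ gp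

/-- Local integrability of `G_{x,y}(c)` and of `Ĝ_x(c) = G_{x,x}(c)`. -/
def CondH1 {N : ℕ} (G : E N → E N → ℝ → ℝ) : Prop :=
  ∀ c : ℝ, 0 < c → ∀ A : Set (E N), IsCompact A →
    IntegrableOn (fun p : E N × E N => G p.1 p.2 c) (A ×ˢ A) volume ∧
      IntegrableOn (fun x : E N => G x x c) A volume

/-- Translation invariance of `G`. -/
def CondH2 {N : ℕ} (G : E N → E N → ℝ → ℝ) : Prop :=
  ∀ x y z : E N, ∀ t : ℝ, 0 ≤ t → G (x - z) (y - z) t = G x y t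

/-- The fractional boundedness condition. -/
def CondBf {N : ℕ} (G : E N → E N → ℝ → ℝ) : Prop :=
  ∃ C₁ C₂ : ℝ, 0 < C₁ ∧ 0 < C₂ ∧ ∀ x y : E N, C₁ ≤ G x y 1 ∧ G x y 1 ≤ C₂

/-! ### The function spaces -/

/-- The modular `∫ Ĝ_x(|u(x)|) dx`, with values in `[0, ∞]`. -/
def modular {N : ℕ} (G : E N → E N → ℝ → ℝ) (u : E N → ℝ) : ℝ≥0∞ :=
  ∫⁻ x : E N, ENNReal.ofReal (G x x |u x|)

/-- The modular `∫∫ G_{x,y}(|u(x) - u(y)| / |x - y|^s) |x - y|^{-N} dx dy`,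
with values in `[0, ∞]`. -/
def fracModular {N : ℕ} (G : E N → E N → ℝ → ℝ) (s : ℝ) (u : E N → ℝ) : ℝ≥0∞ :=
  ∫⁻ p : E N × E N,
    ENNReal.ofReal (G p.1 p.2 (|u p.1 - u p.2| / ‖p.1 - p.2‖ ^ s) / ‖p.1 - p.2‖ ^ N)

/-- The Luxemburg functional `inf {r > 0 : J(u / r) ≤ 1}` of a modular `J`
(equal to `∞` when there is no such `r`). -/
def luxemburg {N : ℕ} (J : (E N → ℝ) → ℝ≥0∞) (u : E N → ℝ) : ℝ≥0∞ :=
  ⨅ (r : ℝ) (_ : 0 < r) (_ : J (fun x => u x / r) ≤ 1), ENNReal.ofReal r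

/-- `‖u‖_{W^{s,G}(ℝ^N)}`: the Luxemburg norm in `L^Ĝ` plus the Gagliardo seminorm. -/
def sobolevNorm {N : ℕ} (G : E N → E N → ℝ → ℝ) (s : ℝ) (u : E N → ℝ) : ℝ≥0∞ :=
  luxemburg (modular G) u + luxemburg (fracModular G s) u

/-- The Musielak–Orlicz space `L^Ĝ(ℝ^N)`. -/
def musielakOrlicz {N : ℕ} (G : E N → E N → ℝ → ℝ) : Set (E N → ℝ) :=
  {u | AEMeasurable u volume ∧ ∃ r : ℝ, 0 < r ∧ modular G (fun x => r * u x) < ⊤}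

/-- The fractional Musielak–Sobolev space `W^{s,G}(ℝ^N)`. -/
def fracSobolev {N : ℕ} (G : E N → E N → ℝ → ℝ) (s : ℝ) : Set (E N → ℝ) :=
  {u | u ∈ musielakOrlicz G ∧ ∃ r : ℝ, 0 < r ∧ fracModular G s (fun x => r * u x) < ⊤}

/-- `W_0^{s,G}(Ω)`: the functions of `W^{s,G}(ℝ^N)` vanishing a.e. outside `Ω`. -/
def fracSobolevZero {N : ℕ} (G : E N → E N → ℝ → ℝ) (s : ℝ) (Ω : Set (E N)) :
    Set (E N → ℝ) :=
  {u | u ∈ fracSobolev G s ∧ ∀ᵐ x ∂(volume : Measure (E N)), x ∉ Ω → u x = 0}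

/-- `C_0^∞(Ω)`: smooth functions on `ℝ^N` whose support is compact and contained in `Ω`. -/
def testFunctions {N : ℕ} (Ω : Set (E N)) : Set (E N → ℝ) :=
  {φ | ContDiff ℝ ∞ φ ∧ HasCompactSupport φ ∧ tsupport φ ⊆ Ω}

/-- A hypograph in `ℝ^{n+1}`: the image under a rigid motion of
`{(x', x_{n+1}) : x_{n+1} < ξ(x')}` for a continuous `ξ : ℝ^n → ℝ`. -/
def IsHypograph {n : ℕ} (Ω : Set (E (n + 1))) : Prop :=
  ∃ (ξ : E n → ℝ) (R : E (n + 1) ≃ᵃⁱ[ℝ] E (n + 1)), Continuous ξ ∧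
    Ω = R '' {x : E (n + 1) |
      x (Fin.last n) < ξ (WithLp.toLp 2 fun i : Fin n => x (Fin.castSucc i))}

end FracMusielak

end

/-! By (g4), `t G'(t) ≤ g⁺ G(t)`, so `G` is doubling with a constant uniform in `(x, y)`. Small
modulars therefore force a small Luxemburg norm, and it suffices to approximate in the sum of the
two modulars (`totalModular`).

The main tool is a Fatou argument, `YoungFamily.tendsto_modular_sub`: if functions converge a.e. and
their modulars never exceed the finite modular of the limit, then the modular of the difference
tends to 0. Three operations fit it: clipping, being 1-Lipschitz; translation, by (H2); and
mollification, an average of translates, by Jensen's inequality (`YoungFamily.modular_integral_le`).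
A spatial cutoff may increase the fractional modular, so there dominated convergence is used
instead. By convexity and the uniform bound on `G_{x,y}(1)`, the new term is dominated by the kernel
`min(1,|z|)|z|^{-s-N}`, integrable because `0 < s < 1` (`integrable_kernel`). The same bound puts
test functions in the space.

The operations are chained: clipping gives a bounded function with support of finite measure, the
cutoff confines it to a ball, a downward push makes it vanish off a compact subset of the hypograph,
and mollification makes it smooth. -/

noncomputable section

namespace FracMusielak

/-! ### Families of Young functions and their modulars -/

/-- A measurable family of Young functions on `[0, ∞)` satisfying a uniform doubling condition. -/
structure YoungFamily {X : Type*} [MeasurableSpace X] (μ : Measure X) (K : ℝ)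
    (Φ : X → ℝ → ℝ) : Prop where
  nonneg_const : 0 ≤ K
  convex : ∀ p, ConvexOn ℝ (Ici 0) (Φ p)
  cont : ∀ p, ContinuousOn (Φ p) (Ici 0)
  zero : ∀ p, Φ p 0 = 0
  mono : ∀ p, MonotoneOn (Φ p) (Ici 0)
  double : ∀ p t, 0 ≤ t → Φ p (2 * t) ≤ K * Φ p t
  meas : ∃ Ψ : X → ℝ → ℝ, Measurable (Function.uncurry Ψ) ∧
    ∀ᵐ p ∂μ, ∀ t, 0 ≤ t → Φ p t = Ψ p t

/-- The modular `∫ Φ(p, |W(p)|) dp`. -/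
def youngModular {X : Type*} [MeasurableSpace X] (μ : Measure X) (Φ : X → ℝ → ℝ)
    (W : X → ℝ) : ℝ≥0∞ :=
  ∫⁻ p, ENNReal.ofReal (Φ p |W p|) ∂μ

/-- A Carathéodory function agrees almost everywhere with a jointly measurable function. -/
theorem exists_measurable_uncurry {X : Type*} [MeasurableSpace X] {μ : Measure X}
    {Φ : X → ℝ → ℝ} (hm : ∀ t, 0 ≤ t → AEMeasurable (fun p => Φ p t) μ)
    (hc : ∀ p, ContinuousOn (Φ p) (Ici 0)) :
    ∃ Ψ : X → ℝ → ℝ, Measurable (Function.uncurry Ψ) ∧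
      ∀ᵐ p ∂μ, ∀ t, 0 ≤ t → Φ p t = Ψ p t := by
  classical
  have hm' : ∀ q : ℚ, AEMeasurable (fun p => Φ p |(q : ℝ)|) μ := fun q => hm _ (abs_nonneg _)
  have hae : ∀ᵐ p ∂μ, ∀ q : ℚ, Φ p |(q : ℝ)| = (hm' q).mk _ p :=
    ae_all_iff.2 fun q => (hm' q).ae_eq_mk
  -- Continuity in `t` reduces all times to rational ones, so a single null set suffices. It is
  -- enlarged to a measurable set on which `Ψ` is put equal to 0.
  set B : Set X := toMeasurable μ {p | ¬ ∀ q : ℚ, Φ p |(q : ℝ)| = (hm' q).mk _ p} with hB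
  have hBm : MeasurableSet B := measurableSet_toMeasurable _ _
  have hB0 : μ B = 0 := by rw [hB, measure_toMeasurable]; exact hae
  have hcont : ∀ p, Continuous fun t : ℝ => Φ p |t| := fun p =>
    (hc p).comp_continuous continuous_abs fun t => abs_nonneg t
  set Ψ : X → ℝ → ℝ := fun p t => if p ∈ B then 0 else Φ p |t| with hΨ
  have hΨc : ∀ p, Continuous fun t : ℝ => Ψ p t := by
    intro p
    by_cases hp : p ∈ B
    · simpa [hΨ, hp] using continuous_const
    · simpa [hΨ, hp] using hcont p
  have hΨq : ∀ q : ℚ, Measurable fun p => Ψ p q := by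
    intro q
    have : (fun p => Ψ p q) = fun p => if p ∈ B then 0 else (hm' q).mk _ p := by
      funext p
      by_cases hp : p ∈ B
      · simp [hΨ, hp]
      · have h1 : p ∉ {p | ¬ ∀ q : ℚ, Φ p |(q : ℝ)| = (hm' q).mk _ p} :=
          fun h => hp (subset_toMeasurable _ _ h)
        simp only [mem_ofPred_eq, not_not] at h1
        simp only [hΨ, hp, if_false]
        exact h1 q
    rw [this]
    exact Measurable.ite hBm measurable_const (hm' q).measurable_mk
  have hΨm : ∀ t : ℝ, Measurable fun p => Ψ p t := by
    intro t
    obtain ⟨v, hv, hvt⟩ := mem_closure_iff_seq_limit.1 (Rat.denseRange_cast (𝕜 := ℝ) t)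
    refine measurable_of_tendsto_metrizable (f := fun n p => Ψ p (v n)) (fun n => ?_) ?_
    · obtain ⟨q, hq⟩ := hv n
      simpa [← hq] using hΨq q
    · exact tendsto_pi_nhds.2 fun p => ((hΨc p).tendsto t).comp hvt
  refine ⟨Ψ, ?_, ?_⟩
  · have := (measurable_uncurry_of_continuous_of_measurable (u := fun t p => Ψ p t) hΨc hΨm).comp
      measurable_swap
    exact this
  · have : ∀ᵐ p ∂μ, p ∉ B := measure_eq_zero_iff_ae_notMem.1 hB0
    filter_upwards [this] with p hp t ht
    simp [hΨ, hp, abs_of_nonneg ht]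

namespace YoungFamily

variable {X : Type*} [MeasurableSpace X] {μ : Measure X} {K : ℝ} {Φ : X → ℝ → ℝ}

theorem nonneg (h : YoungFamily μ K Φ) (p : X) {t : ℝ} (ht : 0 ≤ t) : 0 ≤ Φ p t := by
  rw [← h.zero p]; exact h.mono p (mem_Ici.2 le_rfl) (mem_Ici.2 ht) ht

theorem le_of_le (h : YoungFamily μ K Φ) (p : X) {a b : ℝ} (ha : 0 ≤ a) (hab : a ≤ b) :
    Φ p a ≤ Φ p b :=
  h.mono p (mem_Ici.2 ha) (mem_Ici.2 (ha.trans hab)) hab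

theorem continuous_abs (h : YoungFamily μ K Φ) (p : X) : Continuous fun t : ℝ => Φ p |t| :=
  (h.cont p).comp_continuous _root_.continuous_abs fun t => abs_nonneg t

theorem aemeasurable (h : YoungFamily μ K Φ) {W : X → ℝ} (hW : AEMeasurable W μ) :
    AEMeasurable (fun p => ENNReal.ofReal (Φ p |W p|)) μ := by
  obtain ⟨Ψ, hΨ, hae⟩ := h.meas
  refine AEMeasurable.ennreal_ofReal ?_
  have h1 : AEMeasurable (fun p => Ψ p |W p|) μ :=
    hΨ.comp_aemeasurable (aemeasurable_id.prodMk (measurable_norm.comp_aemeasurable hW))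
  refine h1.congr ?_
  filter_upwards [hae] with p hp
  exact (hp _ (abs_nonneg _)).symm

theorem pow_double (h : YoungFamily μ K Φ) (p : X) (k : ℕ) {t : ℝ} (ht : 0 ≤ t) :
    Φ p (2 ^ k * t) ≤ K ^ k * Φ p t := by
  induction k with
  | zero => simp
  | succ k ih =>
    calc Φ p (2 ^ (k + 1) * t) = Φ p (2 * (2 ^ k * t)) := by ring_nf
      _ ≤ K * Φ p (2 ^ k * t) := h.double p _ (by positivity)
      _ ≤ K * (K ^ k * Φ p t) := mul_le_mul_of_nonneg_left ih h.nonneg_const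
      _ = K ^ (k + 1) * Φ p t := by ring

/-- Since `|a + b| ≤ 2 max(|a|, |b|)`, monotonicity and doubling suffice. -/
theorem add_le (h : YoungFamily μ K Φ) (p : X) (a b : ℝ) :
    Φ p |a + b| ≤ K * (Φ p |a| + Φ p |b|) := by
  have key : ∀ a b : ℝ, |a| ≤ |b| → Φ p |a + b| ≤ K * (Φ p |a| + Φ p |b|) := by
    intro a b hab
    calc Φ p |a + b| ≤ Φ p (2 * |b|) :=
          h.le_of_le p (abs_nonneg _) (
            (abs_add_le a b).trans (by linarith))
      _ ≤ K * Φ p |b| := h.double p _ (abs_nonneg _)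
      _ ≤ _ := mul_le_mul_of_nonneg_left
          (by linarith [h.nonneg p (abs_nonneg a)]) h.nonneg_const
  rcases le_total |a| |b| with hab | hab
  · exact key a b hab
  · rw [add_comm a, add_comm (Φ p |a|)]; exact key b a hab

theorem ofReal_add_le (h : YoungFamily μ K Φ) (p : X) (a b : ℝ) :
    ENNReal.ofReal (Φ p |a + b|) ≤
      ENNReal.ofReal K * (ENNReal.ofReal (Φ p |a|) + ENNReal.ofReal (Φ p |b|)) := by
  rw [← ENNReal.ofReal_add (h.nonneg p (abs_nonneg _)) (h.nonneg p (abs_nonneg _)),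
    ← ENNReal.ofReal_mul h.nonneg_const]
  exact ENNReal.ofReal_le_ofReal (h.add_le p a b)

theorem modular_add_le (h : YoungFamily μ K Φ) {V W : X → ℝ} (hV : AEMeasurable V μ) :
    youngModular μ Φ (fun p => V p + W p) ≤
      ENNReal.ofReal K * (youngModular μ Φ V + youngModular μ Φ W) := by
  unfold youngModular
  rw [← lintegral_add_left' (h.aemeasurable hV), ← lintegral_const_mul' _ _ ENNReal.ofReal_ne_top]
  exact lintegral_mono fun p => h.ofReal_add_le p _ _

theorem modular_mono (h : YoungFamily μ K Φ) {V W : X → ℝ} (hVW : ∀ p, |V p| ≤ |W p|) :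
    youngModular μ Φ V ≤ youngModular μ Φ W :=
  lintegral_mono fun p => ENNReal.ofReal_le_ofReal
    (h.le_of_le p (abs_nonneg _) (hVW p))

theorem modular_pow_le (h : YoungFamily μ K Φ) (k : ℕ) (W : X → ℝ) :
    youngModular μ Φ (fun p => 2 ^ k * W p) ≤ ENNReal.ofReal (K ^ k) * youngModular μ Φ W := by
  unfold youngModular
  rw [← lintegral_const_mul' _ _ ENNReal.ofReal_ne_top]
  refine lintegral_mono fun p => ?_
  dsimp only
  rw [← ENNReal.ofReal_mul (pow_nonneg h.nonneg_const k), abs_mul, abs_of_pos (by positivity)]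
  exact ENNReal.ofReal_le_ofReal (h.pow_double p k (abs_nonneg _))

theorem exists_modular_mul_le (h : YoungFamily μ K Φ) (r : ℝ) :
    ∃ C : ℝ, 0 < C ∧ ∀ W : X → ℝ,
      youngModular μ Φ (fun p => r * W p) ≤ ENNReal.ofReal C * youngModular μ Φ W := by
  obtain ⟨k, hk⟩ := pow_unbounded_of_one_lt |r| (one_lt_two)
  -- The summand 1 keeps the constant positive even if `K = 0`.
  refine ⟨K ^ k + 1, by have := pow_nonneg h.nonneg_const k; positivity, fun W => ?_⟩
  refine (h.modular_mono fun p => ?_).trans ((h.modular_pow_le k W).trans ?_)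
  · rw [abs_mul, abs_mul, abs_of_pos (a := (2 : ℝ) ^ k) (by positivity)]
    gcongr
  · gcongr; linarith

/-- Doubling makes division by `r` cost only a factor `C`, so `δ = 1 / C` works: this is how small
modular becomes small norm. -/
theorem exists_modular_div_le_one (h : YoungFamily μ K Φ) {r : ℝ} :
    ∃ δ : ℝ≥0∞, 0 < δ ∧ ∀ W : X → ℝ, youngModular μ Φ W ≤ δ →
      youngModular μ Φ (fun p => W p / r) ≤ 1 := by
  obtain ⟨C, hC, hCW⟩ := h.exists_modular_mul_le r⁻¹
  refine ⟨ENNReal.ofReal C⁻¹, by simpa using hC, fun W hW => ?_⟩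
  have := (hCW W).trans (mul_le_mul_right hW _)
  rw [← ENNReal.ofReal_mul hC.le, mul_inv_cancel₀ hC.ne', ENNReal.ofReal_one] at this
  simpa [div_eq_inv_mul] using this

/-- Almost everywhere convergence without increase of the modular implies modular convergence. -/
theorem tendsto_modular_sub (h : YoungFamily μ K Φ) {W : X → ℝ} {V : ℕ → X → ℝ}
    (hW : AEMeasurable W μ) (hV : ∀ n, AEMeasurable (V n) μ)
    (hlim : ∀ᵐ p ∂μ, Tendsto (fun n => V n p) atTop (𝓝 (W p)))
    (hfin : youngModular μ Φ W ≠ ⊤)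
    (hle : ∀ n, youngModular μ Φ (V n) ≤ youngModular μ Φ W) :
    Tendsto (fun n => youngModular μ Φ (fun p => W p - V n p)) atTop (𝓝 0) := by
  set c : ℝ≥0∞ := ENNReal.ofReal K
  have hc : c ≠ ⊤ := ENNReal.ofReal_ne_top
  set B : ℝ≥0∞ := c * (youngModular μ Φ W + youngModular μ Φ W) with hB
  have hBtop : B ≠ ⊤ := ENNReal.mul_ne_top hc (ENNReal.add_ne_top.2 ⟨hfin, hfin⟩)
  set f : ℕ → X → ℝ≥0∞ := fun n p => ENNReal.ofReal (Φ p |W p - V n p|) with hf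
  set g : ℕ → X → ℝ≥0∞ := fun n p =>
    c * (ENNReal.ofReal (Φ p |W p|) + ENNReal.ofReal (Φ p |V n p|)) with hg
  set g₀ : X → ℝ≥0∞ := fun p =>
    c * (ENNReal.ofReal (Φ p |W p|) + ENNReal.ofReal (Φ p |W p|)) with hg₀
  have hfm : ∀ n, AEMeasurable (f n) μ := fun n => h.aemeasurable (hW.sub (hV n))
  have hgm : ∀ n, AEMeasurable (g n) μ := fun n =>
    ((h.aemeasurable hW).add (h.aemeasurable (hV n))).const_mul c
  have hfg : ∀ n p, f n p ≤ g n p := by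
    intro n p
    have := h.ofReal_add_le p (W p) (-V n p)
    simpa [hf, hg, sub_eq_add_neg] using this
  -- The majorant `g n` varies with `n`; the hypothesis `hle` bounds its integral by that of its
  -- limit `g₀`.
  have hintg : ∀ n, ∫⁻ p, g n p ∂μ ≤ B := by
    intro n
    rw [hg, hB]
    simp only
    rw [lintegral_const_mul' _ _ hc, lintegral_add_left' (h.aemeasurable hW)]
    exact mul_le_mul_right (add_le_add le_rfl (hle n)) _
  have hintg₀ : ∫⁻ p, g₀ p ∂μ = B := by
    rw [hg₀, hB, lintegral_const_mul' _ _ hc, lintegral_add_left' (h.aemeasurable hW)]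
    rfl
  have hf0 : ∀ᵐ p ∂μ, Tendsto (fun n => f n p) atTop (𝓝 0) := by
    filter_upwards [hlim] with p hp
    have h1 : Tendsto (fun n => W p - V n p) atTop (𝓝 0) := by
      simpa using hp.const_sub (W p)
    have h2 := (ENNReal.continuous_ofReal.comp (h.continuous_abs p)).tendsto 0 |>.comp h1
    simpa [h.zero p, Function.comp_def] using h2
  have hglim : ∀ᵐ p ∂μ, Tendsto (fun n => g n p) atTop (𝓝 (g₀ p)) := by
    filter_upwards [hlim] with p hp
    have h2 := (ENNReal.continuous_ofReal.comp (h.continuous_abs p)).tendsto (W p) |>.comp hp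
    exact ENNReal.Tendsto.const_mul (tendsto_const_nhds.add h2) (Or.inr hc)
  have hsub : ∀ᵐ p ∂μ, g₀ p = liminf (fun n => g n p - f n p) atTop := by
    filter_upwards [hf0, hglim] with p h1 h2
    have := ENNReal.Tendsto.sub h2 h1 (Or.inr ENNReal.zero_ne_top)
    rw [tsub_zero] at this
    exact this.liminf_eq.symm
  have hfB : ∀ n, ∫⁻ p, f n p ∂μ ≤ B := fun n => (lintegral_mono (hfg n)).trans (hintg n)
  -- Fatou's lemma for `g n - f n ≥ 0`, which tends to `g₀`. As `B` is finite, the limsup must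
  -- vanish.
  have hkey : B ≤ B - limsup (fun n => ∫⁻ p, f n p ∂μ) atTop := by
    calc B = ∫⁻ p, liminf (fun n => g n p - f n p) atTop ∂μ := by
          rw [← hintg₀]; exact lintegral_congr_ae hsub
      _ ≤ liminf (fun n => ∫⁻ p, (g n p - f n p) ∂μ) atTop :=
          lintegral_liminf_le' fun n => (hgm n).sub (hfm n)
      _ ≤ liminf (fun n => B - ∫⁻ p, f n p ∂μ) atTop := by
          refine liminf_le_liminf (Eventually.of_forall fun n => ?_)
          rw [lintegral_sub' (hfm n) (ne_top_of_le_ne_top hBtop (hfB n))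
            (Eventually.of_forall (hfg n))]
          exact tsub_le_tsub_right (hintg n) _
      _ = B - limsup (fun n => ∫⁻ p, f n p ∂μ) atTop := ENNReal.liminf_const_sub _ _ hBtop
  have hlimsup : limsup (fun n => ∫⁻ p, f n p ∂μ) atTop ≤ 0 := by
    have h1 : limsup (fun n => ∫⁻ p, f n p ∂μ) atTop ≤ B :=
      limsup_le_of_le (by isBoundedDefault) (Eventually.of_forall hfB)
    by_contra hne
    have hB0 : B ≠ 0 := fun h0 => hne (by simpa [h0] using h1)
    exact absurd hkey (not_le.2 (ENNReal.sub_lt_self hBtop hB0 (fun h0 => hne h0.le)))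
  exact tendsto_of_le_liminf_of_limsup_le zero_le hlimsup

/-- Dominated convergence for modulars. -/
theorem tendsto_modular_of_dominated (h : YoungFamily μ K Φ) {V : ℕ → X → ℝ} {D : X → ℝ≥0∞}
    (hV : ∀ n, AEMeasurable (V n) μ)
    (hlim : ∀ᵐ p ∂μ, Tendsto (fun n => V n p) atTop (𝓝 0))
    (hD : ∫⁻ p, D p ∂μ ≠ ⊤) (hle : ∀ n p, ENNReal.ofReal (Φ p |V n p|) ≤ D p) :
    Tendsto (fun n => youngModular μ Φ (V n)) atTop (𝓝 0) := by
  have := tendsto_lintegral_of_dominated_convergence' (μ := μ)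
    (F := fun n p => ENNReal.ofReal (Φ p |V n p|)) (f := fun _ => 0) D
    (fun n => h.aemeasurable (hV n)) (fun n => Eventually.of_forall (hle n)) hD (by
      filter_upwards [hlim] with p hp
      have h2 := (ENNReal.continuous_ofReal.comp (h.continuous_abs p)).tendsto 0 |>.comp hp
      simpa [h.zero p, Function.comp_def] using h2)
  simpa [youngModular] using this

/-- Pointwise Jensen inequality. -/
theorem ofReal_integral_le (h : YoungFamily μ K Φ) {Y : Type*} [MeasurableSpace Y]
    {ν : Measure Y} [IsProbabilityMeasure ν] (p : X) {f : Y → ℝ} (hf : Integrable f ν) :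
    ENNReal.ofReal (Φ p |∫ y, f y ∂ν|) ≤ ∫⁻ y, ENNReal.ofReal (Φ p |f y|) ∂ν := by
  by_cases hi : Integrable (fun y => Φ p |f y|) ν
  · rw [← ofReal_integral_eq_lintegral_ofReal hi
      (Eventually.of_forall fun y => h.nonneg p (abs_nonneg _))]
    refine ENNReal.ofReal_le_ofReal ?_
    calc Φ p |∫ y, f y ∂ν| ≤ Φ p (∫ y, |f y| ∂ν) :=
          h.le_of_le p (abs_nonneg _)
            (abs_integral_le_integral_abs)
      _ ≤ ∫ y, Φ p |f y| ∂ν :=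
          (h.convex p).map_integral_le (h.cont p) isClosed_Ici
            (Eventually.of_forall fun y => abs_nonneg (f y)) hf.abs hi
  · have hm : AEStronglyMeasurable (fun y => Φ p |f y|) ν :=
      (h.continuous_abs p).comp_aestronglyMeasurable hf.aestronglyMeasurable
    have : ∫⁻ y, ENNReal.ofReal (Φ p |f y|) ∂ν = ⊤ := by
      by_contra hne
      refine hi ⟨hm, ?_⟩
      rw [hasFiniteIntegral_iff_ofReal (Eventually.of_forall fun y => h.nonneg p (abs_nonneg _))]
      exact lt_top_iff_ne_top.2 hne
    rw [this]; exact le_top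

/-- Averaging does not increase the modular. -/
theorem modular_integral_le [SFinite μ] (h : YoungFamily μ K Φ) {Y : Type*} [MeasurableSpace Y]
    {ν : Measure Y} [IsProbabilityMeasure ν] {F : X → Y → ℝ}
    (hF : Measurable (Function.uncurry F)) (hi : ∀ p, Integrable (F p) ν) {c : ℝ≥0∞}
    (hc : ∀ y, youngModular μ Φ (fun p => F p y) ≤ c) :
    youngModular μ Φ (fun p => ∫ y, F p y ∂ν) ≤ c := by
  obtain ⟨Ψ, hΨ, hae⟩ := h.meas
  -- Tonelli needs joint measurability, which is available for `Ψ` and not for `Φ`.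
  have hm : Measurable (Function.uncurry fun p y => ENNReal.ofReal (Ψ p |F p y|)) :=
    (hΨ.comp (measurable_fst.prodMk (measurable_norm.comp hF))).ennreal_ofReal
  calc youngModular μ Φ (fun p => ∫ y, F p y ∂ν)
      ≤ ∫⁻ p, ∫⁻ y, ENNReal.ofReal (Φ p |F p y|) ∂ν ∂μ :=
        lintegral_mono fun p => h.ofReal_integral_le p (hi p)
    _ = ∫⁻ p, ∫⁻ y, ENNReal.ofReal (Ψ p |F p y|) ∂ν ∂μ := by
        refine lintegral_congr_ae ?_
        filter_upwards [hae] with p hp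
        simp only [hp _ (abs_nonneg _)]
    _ = ∫⁻ y, ∫⁻ p, ENNReal.ofReal (Ψ p |F p y|) ∂μ ∂ν :=
        lintegral_lintegral_swap hm.aemeasurable
    _ = ∫⁻ y, youngModular μ Φ (fun p => F p y) ∂ν := by
        refine lintegral_congr fun y => lintegral_congr_ae ?_
        filter_upwards [hae] with p hp
        simp only [hp _ (abs_nonneg _)]
    _ ≤ ∫⁻ _, c ∂ν := lintegral_mono hc
    _ = c := by simp

end YoungFamily

/-! ### Properties of `G` -/

/-- The properties of `G` used for the density of test functions. -/
structure IsAdmissible {N : ℕ} (K C : ℝ) (G : E N → E N → ℝ → ℝ) : Prop where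
  nonneg_const : 0 ≤ K
  convex : ∀ x y, ConvexOn ℝ (Ici 0) (G x y)
  carath : IsCaratheodory G
  zero : ∀ x y, G x y 0 = 0
  mono : ∀ x y, MonotoneOn (G x y) (Ici 0)
  double : ∀ x y t, 0 ≤ t → G x y (2 * t) ≤ K * G x y t
  pos : ∀ x y t, 0 < t → 0 < G x y t
  invariant : CondH2 G
  bound : ∀ x y, G x y 1 ≤ C

section gFun

variable {N : ℕ} {a : E N → E N → ℝ → ℝ}

theorem gFun_of_pos {x y : E N} {t : ℝ} (ht : 0 < t) : gFun a x y t = a x y t * t := by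
  simp [gFun, ht.ne']

theorem gFun_nonneg (ha : ∀ x y : E N, ∀ t : ℝ, 0 < t → 0 ≤ a x y t) {x y : E N} {t : ℝ}
    (ht : 0 ≤ t) : 0 ≤ gFun a x y t := by
  rcases ht.eq_or_lt with rfl | h
  · simp [gFun]
  · rw [gFun_of_pos h]; exact mul_nonneg (ha x y t h) ht

theorem gFun_monotoneOn (ha : ∀ x y : E N, ∀ t : ℝ, 0 < t → 0 ≤ a x y t) (hg3 : CondG3 a)
    (x y : E N) : MonotoneOn (gFun a x y) (Ici 0) := by
  intro r hr t ht hrt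
  rw [mem_Ici] at hr ht
  rcases hr.eq_or_lt with rfl | h
  · simpa [gFun] using gFun_nonneg ha (x := x) (y := y) ht
  · rw [gFun_of_pos h, gFun_of_pos (h.trans_le hrt)]
    exact hg3 x y (mem_Ioi.2 h) (mem_Ioi.2 (h.trans_le hrt)) hrt

theorem gFun_intervalIntegrable (ha : ∀ x y : E N, ∀ t : ℝ, 0 < t → 0 ≤ a x y t)
    (hg3 : CondG3 a) (x y : E N) {r t : ℝ} (hr : 0 ≤ r) (ht : 0 ≤ t) :
    IntervalIntegrable (gFun a x y) volume r t :=
  MonotoneOn.intervalIntegrable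
    ((gFun_monotoneOn ha hg3 x y).mono fun _ hz => mem_Ici.2 ((le_min hr ht).trans hz.1))

theorem GFun_hasDerivAt (ha : ∀ x y : E N, ∀ t : ℝ, 0 < t → 0 ≤ a x y t) (hg2 : CondG2 a)
    (hg3 : CondG3 a) (x y : E N) {t : ℝ} (ht : 0 < t) :
    HasDerivAt (GFun a x y) (gFun a x y t) t := by
  have hc : ContinuousOn (gFun a x y) (Ioi 0) := by
    refine ((hg2 x y).mul continuousOn_id).congr fun z hz => ?_
    exact gFun_of_pos hz
  exact intervalIntegral.integral_hasDerivAt_right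
    (gFun_intervalIntegrable ha hg3 x y le_rfl ht.le)
    (hc.stronglyMeasurableAtFilter isOpen_Ioi t ht)
    (hc.continuousAt (isOpen_Ioi.mem_nhds ht))

theorem GFun_zero (x y : E N) : GFun a x y 0 = 0 := by simp [GFun]

/-- If `G` vanished at `t`, the quotient in `CondG4` would be 0 by the convention `x / 0 = 0`,
against `gm > 1`. -/
theorem GFun_pos (hg4 : CondG4 a) (ha : ∀ x y : E N, ∀ t : ℝ, 0 < t → 0 ≤ a x y t)
    (x y : E N) {t : ℝ} (ht : 0 < t) : 0 < GFun a x y t := by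
  obtain ⟨gm, gp, h1, h⟩ := hg4
  have hnn : 0 ≤ GFun a x y t :=
    intervalIntegral.integral_nonneg ht.le fun u hu => gFun_nonneg ha hu.1
  refine lt_of_le_of_ne hnn fun h0 => ?_
  have := (h x y t ht).1
  rw [← h0, div_zero] at this
  linarith

theorem GFun_monotoneOn (ha : ∀ x y : E N, ∀ t : ℝ, 0 < t → 0 ≤ a x y t) (hg2 : CondG2 a)
    (hg3 : CondG3 a) (hG : IsCaratheodory (GFun a)) (x y : E N) :
    MonotoneOn (GFun a x y) (Ici 0) := by
  refine monotoneOn_of_deriv_nonneg (convex_Ici 0) (hG.2 x y) ?_ ?_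
  · rw [interior_Ici]
    exact fun t ht => (GFun_hasDerivAt ha hg2 hg3 x y ht).differentiableAt.differentiableWithinAt
  · rw [interior_Ici]
    intro t ht
    rw [(GFun_hasDerivAt ha hg2 hg3 x y ht).deriv]
    exact gFun_nonneg ha (le_of_lt ht)

theorem GFun_convexOn (ha : ∀ x y : E N, ∀ t : ℝ, 0 < t → 0 ≤ a x y t) (hg2 : CondG2 a)
    (hg3 : CondG3 a) (hG : IsCaratheodory (GFun a)) (x y : E N) :
    ConvexOn ℝ (Ici 0) (GFun a x y) := by
  refine MonotoneOn.convexOn_of_deriv (convex_Ici 0) (hG.2 x y) ?_ ?_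
  · rw [interior_Ici]
    exact fun t ht => (GFun_hasDerivAt ha hg2 hg3 x y ht).differentiableAt.differentiableWithinAt
  · rw [interior_Ici]
    intro r hr t ht hrt
    rw [(GFun_hasDerivAt ha hg2 hg3 x y ht).deriv, (GFun_hasDerivAt ha hg2 hg3 x y hr).deriv]
    exact gFun_monotoneOn ha hg3 x y (mem_Ici.2 (le_of_lt hr)) (mem_Ici.2 (le_of_lt ht)) hrt

/-- The upper bound in (g4) reads `t G' ≤ gp G`, so `G(t) t^(-gp)` is nonincreasing; compare its
values at `t` and `2t`. -/
theorem GFun_two_mul_le (ha : ∀ x y : E N, ∀ t : ℝ, 0 < t → 0 ≤ a x y t) (hg2 : CondG2 a)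
    (hg3 : CondG3 a) {gm gp : ℝ} (h1 : 1 < gm) (hg : ∀ x y : E N, ∀ t : ℝ, 0 < t →
    gm ≤ a x y t * t ^ 2 / GFun a x y t ∧ a x y t * t ^ 2 / GFun a x y t ≤ gp)
    (x y : E N) {t : ℝ} (ht : 0 ≤ t) :
    GFun a x y (2 * t) ≤ (2 : ℝ) ^ gp * GFun a x y t := by
  rcases ht.eq_or_lt with rfl | htp
  · simp [GFun_zero]
  have hd : ∀ r : ℝ, 0 < r → HasDerivAt (fun r => GFun a x y r * r ^ (-gp))
      (gFun a x y r * r ^ (-gp) + GFun a x y r * (-gp * r ^ (-gp - 1))) r := fun r hr =>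
    (GFun_hasDerivAt ha hg2 hg3 x y hr).mul (Real.hasDerivAt_rpow_const (Or.inl hr.ne'))
  have hanti : AntitoneOn (fun r => GFun a x y r * r ^ (-gp)) (Ioi 0) := by
    refine antitoneOn_of_deriv_nonpos (convex_Ioi 0)
      (fun r hr => (hd r hr).continuousAt.continuousWithinAt) ?_ ?_
    · rw [interior_Ioi]
      exact fun r hr => (hd r hr).differentiableAt.differentiableWithinAt
    · rw [interior_Ioi]
      intro r hr
      have hr' : 0 < r := hr
      have hGp := GFun_pos ⟨gm, gp, h1, hg⟩ ha x y hr'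
      have h2 := (hg x y r hr').2
      rw [div_le_iff₀ hGp] at h2
      have h3 : r ^ (-gp) = r ^ (-gp - 1) * r := by
        rw [← Real.rpow_add_one hr'.ne']; ring_nf
      rw [(hd r hr').deriv, h3, gFun_of_pos hr']
      have h4 : 0 < r ^ (-gp - 1) := Real.rpow_pos_of_pos hr' _
      nlinarith
  have h := hanti (mem_Ioi.2 htp) (mem_Ioi.2 (show 0 < 2 * t by positivity))
    (show t ≤ 2 * t by linarith)
  dsimp only at h
  rw [Real.mul_rpow (by norm_num) ht, Real.rpow_neg (by norm_num)] at h
  have hp : 0 < t ^ (-gp) := Real.rpow_pos_of_pos htp _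
  have h2 : (0 : ℝ) < 2 ^ gp := Real.rpow_pos_of_pos (by norm_num) _
  have h5 : GFun a x y (2 * t) * ((2 : ℝ) ^ gp)⁻¹ ≤ GFun a x y t := by
    refine le_of_mul_le_mul_right ?_ hp
    linarith
  rwa [← div_eq_mul_inv, div_le_iff₀' h2] at h5

theorem isAdmissible_GFun (ha : ∀ x y : E N, ∀ t : ℝ, 0 < t → 0 ≤ a x y t)
    (hG : IsCaratheodory (GFun a)) (hg2 : CondG2 a) (hg3 : CondG3 a) (hg4 : CondG4 a)
    (hH2 : CondH2 (GFun a)) (hBf : CondBf (GFun a)) :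
    ∃ K C : ℝ, IsAdmissible K C (GFun a) := by
  obtain ⟨C₁, C₂, -, -, hB⟩ := hBf
  have hg4' := hg4
  obtain ⟨gm, gp, h1, hg⟩ := hg4
  exact ⟨(2 : ℝ) ^ gp, C₂,
    { nonneg_const := Real.rpow_nonneg (by norm_num) _
      convex := GFun_convexOn ha hg2 hg3 hG
      carath := hG
      zero := GFun_zero
      mono := GFun_monotoneOn ha hg2 hg3 hG
      double := fun x y t ht => GFun_two_mul_le ha hg2 hg3 h1 hg x y ht
      pos := fun x y t ht => GFun_pos hg4' ha x y ht
      invariant := hH2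
      bound := fun x y => (hB x y).2 }⟩

end gFun

/-! ### The two modulars as modulars of Young families -/

/-- The integrand of the fractional modular. -/
def fracYoung {N : ℕ} (G : E N → E N → ℝ → ℝ) (s : ℝ) (p : E N × E N) (t : ℝ) : ℝ :=
  G p.1 p.2 (t / ‖p.1 - p.2‖ ^ s) / ‖p.1 - p.2‖ ^ N

variable {N : ℕ} {K C s : ℝ} {G : E N → E N → ℝ → ℝ}

theorem modular_eq_youngModular (G : E N → E N → ℝ → ℝ) (u : E N → ℝ) :
    modular G u = youngModular volume (fun x => G x x) u := rfl

theorem fracModular_eq_youngModular (G : E N → E N → ℝ → ℝ) (s : ℝ) (u : E N → ℝ) :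
    fracModular G s u = youngModular volume (fracYoung G s) (fun p => u p.1 - u p.2) := rfl

theorem CondH2.diag (h : CondH2 G) (x : E N) {t : ℝ} (ht : 0 ≤ t) : G x x t = G 0 0 t := by
  rw [← h x x x t ht, sub_self]

theorem IsAdmissible.youngFamily_diag (h : IsAdmissible K C G) :
    YoungFamily (volume : Measure (E N)) K (fun x => G x x) where
  nonneg_const := h.nonneg_const
  convex x := h.convex x x
  cont x := h.carath.2 x x
  zero x := h.zero x x
  mono x := h.mono x x
  double x := h.double x x
  -- Measurability on the product gives in general no information on the diagonal, a null set when
  -- `N ≥ 1`. Translation invariance makes the function constant there.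
  meas := by
    refine exists_measurable_uncurry (fun t ht => ?_) fun x => h.carath.2 x x
    have : (fun x : E N => G x x t) = fun _ => G 0 0 t :=
      funext fun x => h.invariant.diag x ht
    rw [this]
    exact aemeasurable_const

/-- For fixed `p` the weights are constants, and only their nonnegativity is used; it persists on
the diagonal, so no case distinction is needed. -/
theorem IsAdmissible.youngFamily_frac (h : IsAdmissible K C G) (s : ℝ) :
    YoungFamily (volume : Measure (E N × E N)) K (fracYoung G s) where
  nonneg_const := h.nonneg_const
  convex p := by
    have hw : 0 ≤ ‖p.1 - p.2‖ ^ s := by positivity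
    refine ⟨convex_Ici 0, fun r hr t ht α β hα hβ hαβ => ?_⟩
    have h1 := (h.convex p.1 p.2).2 (mem_Ici.2 (div_nonneg hr hw)) (mem_Ici.2 (div_nonneg ht hw))
      hα hβ hαβ
    simp only [smul_eq_mul, fracYoung] at h1 ⊢
    rw [show (α * r + β * t) / ‖p.1 - p.2‖ ^ s
      = α * (r / ‖p.1 - p.2‖ ^ s) + β * (t / ‖p.1 - p.2‖ ^ s) by ring]
    have hN : 0 ≤ ‖p.1 - p.2‖ ^ N := by positivity
    exact (div_le_div_of_nonneg_right h1 hN).trans_eq (by ring)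
  cont p := by
    refine ContinuousOn.div_const ((h.carath.2 p.1 p.2).comp (by fun_prop) fun t ht => ?_) _
    exact mem_Ici.2 (div_nonneg ht (by positivity))
  zero p := by simp [fracYoung, h.zero]
  mono p := by
    intro r hr t ht hrt
    have hw : 0 ≤ ‖p.1 - p.2‖ ^ s := by positivity
    exact div_le_div_of_nonneg_right (h.mono p.1 p.2 (mem_Ici.2 (div_nonneg hr hw))
      (mem_Ici.2 (div_nonneg ht hw)) (div_le_div_of_nonneg_right hrt hw)) (by positivity)
  double p t ht := by
    have := h.double p.1 p.2 (t / ‖p.1 - p.2‖ ^ s) (by positivity)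
    simp only [fracYoung]
    have hN : 0 ≤ ‖p.1 - p.2‖ ^ N := by positivity
    rw [mul_div_assoc 2 t]
    exact (div_le_div_of_nonneg_right this hN).trans_eq (mul_div_assoc _ _ _)
  meas := by
    obtain ⟨Ψ, hΨ, hae⟩ := exists_measurable_uncurry (μ := (volume : Measure (E N × E N)))
      (Φ := fun p => G p.1 p.2) h.carath.1 fun p => h.carath.2 p.1 p.2
    refine ⟨fun p t => Ψ p (t / ‖p.1 - p.2‖ ^ s) / ‖p.1 - p.2‖ ^ N, ?_, ?_⟩
    · have hn : Measurable fun q : (E N × E N) × ℝ => ‖q.1.1 - q.1.2‖ := by fun_prop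
      exact (hΨ.comp (measurable_fst.prodMk (measurable_snd.div (hn.pow_const s)))).div
        (hn.pow_const N)
    · filter_upwards [hae] with p hp t ht
      simp only [fracYoung]
      rw [hp _ (by positivity)]

/-! ### Translation invariance of the modulars, and their sum -/

theorem CondH2.modular_translate (h : CondH2 G) (u : E N → ℝ) (z : E N) :
    modular G (fun x => u (x + z)) = modular G u := by
  unfold modular
  refine Eq.trans ?_
    (lintegral_add_right_eq_self (fun x => ENNReal.ofReal (G x x |u x|)) z)
  refine lintegral_congr fun x => ?_
  rw [h.diag _ (abs_nonneg _), h.diag (x + z) (abs_nonneg _)]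

theorem CondH2.fracModular_translate (h : CondH2 G) (u : E N → ℝ) (z : E N) :
    fracModular G s (fun x => u (x + z)) = fracModular G s u := by
  unfold fracModular
  have : (volume : Measure (E N × E N)).IsAddRightInvariant :=
    inferInstanceAs ((volume : Measure (E N)).prod (volume : Measure (E N))).IsAddRightInvariant
  -- The shift by `(z, z)` preserves Lebesgue measure and `x - y`; `CondH2` then removes it from
  -- `G`.
  refine Eq.trans ?_ (lintegral_add_right_eq_self (fun p : E N × E N =>
    ENNReal.ofReal (G p.1 p.2 (|u p.1 - u p.2| / ‖p.1 - p.2‖ ^ s) / ‖p.1 - p.2‖ ^ N)) (z, z))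
  refine lintegral_congr fun p => ?_
  have h1 := h (p.1 + z) (p.2 + z) z (|u (p.1 + z) - u (p.2 + z)| / ‖p.1 - p.2‖ ^ s)
    (by positivity)
  simp only [add_sub_cancel_right] at h1
  simp only [Prod.fst_add, Prod.snd_add, add_sub_add_right_eq_sub]
  rw [h1]

theorem modular_congr_ae {u v : E N → ℝ} (h : u =ᵐ[volume] v) : modular G u = modular G v := by
  refine lintegral_congr_ae ?_
  filter_upwards [h] with x hx
  rw [hx]

theorem fracModular_congr_ae {u v : E N → ℝ} (h : u =ᵐ[volume] v) :
    fracModular G s u = fracModular G s v := by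
  refine lintegral_congr_ae ?_
  filter_upwards [Measure.quasiMeasurePreserving_fst.ae_eq_comp h,
    Measure.quasiMeasurePreserving_snd.ae_eq_comp h] with p h1 h2
  simp only [Function.comp_apply] at h1 h2
  rw [h1, h2]

theorem aemeasurable_diff {u : E N → ℝ} (hu : Measurable u) :
    AEMeasurable (fun p : E N × E N => u p.1 - u p.2) volume :=
  ((hu.comp measurable_fst).sub (hu.comp measurable_snd)).aemeasurable

/-- The sum of the two modulars. -/
def totalModular (G : E N → E N → ℝ → ℝ) (s : ℝ) (u : E N → ℝ) : ℝ≥0∞ :=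
  modular G u + fracModular G s u

theorem totalModular_congr_ae {u v : E N → ℝ} (h : u =ᵐ[volume] v) :
    totalModular G s u = totalModular G s v := by
  rw [totalModular, modular_congr_ae h, fracModular_congr_ae h, totalModular]

theorem IsAdmissible.totalModular_sub_le (h : IsAdmissible K C G) {u v w : E N → ℝ}
    (hu : Measurable u) (hv : Measurable v) :
    totalModular G s (fun x => u x - w x) ≤ ENNReal.ofReal K *
      (totalModular G s (fun x => u x - v x) + totalModular G s (fun x => v x - w x)) := by
  have h1 := h.youngFamily_diag.modular_add_le (V := fun x => u x - v x)
    (W := fun x => v x - w x) (hu.sub hv).aemeasurable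
  have h2 := (h.youngFamily_frac s).modular_add_le
    (V := fun p : E N × E N => (u p.1 - v p.1) - (u p.2 - v p.2))
    (W := fun p => (v p.1 - w p.1) - (v p.2 - w p.2)) (aemeasurable_diff (hu.sub hv))
  simp only [totalModular, modular_eq_youngModular, fracModular_eq_youngModular]
  rw [add_add_add_comm, mul_add]
  refine add_le_add (le_of_eq_of_le ?_ h1) (le_of_eq_of_le ?_ h2)
  · simp
  · congr 1; funext p; ring

theorem IsAdmissible.tendsto_totalModular_sub (h : IsAdmissible K C G) {u : E N → ℝ}
    {v : ℕ → E N → ℝ} (hu : Measurable u) (hv : ∀ n, Measurable (v n))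
    (hlim : ∀ᵐ x, Tendsto (fun n => v n x) atTop (𝓝 (u x)))
    (hfin : totalModular G s u ≠ ⊤) (h1 : ∀ n, modular G (v n) ≤ modular G u)
    (h2 : ∀ n, fracModular G s (v n) ≤ fracModular G s u) :
    Tendsto (fun n => totalModular G s (fun x => u x - v n x)) atTop (𝓝 0) := by
  obtain ⟨hf1, hf2⟩ := ENNReal.add_ne_top.1 hfin
  have t1 := h.youngFamily_diag.tendsto_modular_sub hu.aemeasurable
    (fun n => (hv n).aemeasurable) hlim hf1 h1
  have t2 := (h.youngFamily_frac s).tendsto_modular_sub (aemeasurable_diff hu)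
    (fun n => aemeasurable_diff (hv n)) (by
      filter_upwards [Measure.quasiMeasurePreserving_fst.ae hlim,
        Measure.quasiMeasurePreserving_snd.ae hlim] with p hp1 hp2
      exact hp1.sub hp2) hf2 h2
  have t3 := t1.add t2
  rw [add_zero] at t3
  refine t3.congr fun n => ?_
  simp only [totalModular, modular_eq_youngModular, fracModular_eq_youngModular]
  congr 2; funext p; ring

/-! ### From modulars to the norm -/

theorem luxemburg_le {J : (E N → ℝ) → ℝ≥0∞} {u : E N → ℝ} {r : ℝ} (hr : 0 < r)
    (h : J (fun x => u x / r) ≤ 1) : luxemburg J u ≤ ENNReal.ofReal r :=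
  iInf_le_of_le r (iInf_le_of_le hr (iInf_le_of_le h le_rfl))

/-- Smallness of the modulars implies smallness of the norm. -/
theorem IsAdmissible.exists_sobolevNorm_lt (h : IsAdmissible K C G) (s : ℝ) {ε : ℝ}
    (hε : 0 < ε) : ∃ δ : ℝ≥0∞, 0 < δ ∧ ∀ u : E N → ℝ, totalModular G s u < δ →
      sobolevNorm G s u < ENNReal.ofReal ε := by
  -- Each half of the norm is only bounded by `≤`; `ε / 3` leaves room for the strict inequality.
  obtain ⟨δ₁, hδ₁, h1⟩ := h.youngFamily_diag.exists_modular_div_le_one (r := ε / 3)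
  obtain ⟨δ₂, hδ₂, h2⟩ := (h.youngFamily_frac s).exists_modular_div_le_one (r := ε / 3)
  refine ⟨min δ₁ δ₂, lt_min hδ₁ hδ₂, fun u hu => ?_⟩
  have hu1 := h1 u ((le_self_add.trans hu.le).trans (min_le_left _ _))
  have hu2 := h2 _ ((le_add_self.trans hu.le).trans (min_le_right _ _))
  have l1 : luxemburg (modular G) u ≤ ENNReal.ofReal (ε / 3) := luxemburg_le (by positivity) hu1
  have l2 : luxemburg (fracModular G s) u ≤ ENNReal.ofReal (ε / 3) := by
    refine luxemburg_le (by positivity) (le_of_eq_of_le ?_ hu2)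
    rw [fracModular_eq_youngModular]
    congr 1; funext p; ring
  calc sobolevNorm G s u ≤ ENNReal.ofReal (ε / 3) + ENNReal.ofReal (ε / 3) := add_le_add l1 l2
    _ = ENNReal.ofReal (ε / 3 + ε / 3) := (ENNReal.ofReal_add (by positivity) (by positivity)).symm
    _ < ENNReal.ofReal ε := (ENNReal.ofReal_lt_ofReal_iff hε).2 (by linarith)

/-! ### The singular kernel -/

/-- The kernel `min(1, |z|) |z|^{-s-N}`. -/
def kernel {N : ℕ} (s : ℝ) (z : E N) : ℝ := min 1 ‖z‖ / ‖z‖ ^ s / ‖z‖ ^ N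

theorem kernel_neg {N : ℕ} (s : ℝ) (z : E N) : kernel s (-z) = kernel s z := by
  simp [kernel]

theorem measurable_kernel {N : ℕ} (s : ℝ) : Measurable (kernel s : E N → ℝ) :=
  ((measurable_const.min measurable_norm).div (measurable_norm.pow_const s)).div
    (measurable_norm.pow_const N)

/-- In polar coordinates the radial integrand is `r^(-s)` on `(0, 1]`, integrable as `s < 1`, and
`r^(-s-1)` on `(1, ∞)`, integrable as `s > 0`. -/
theorem integrable_kernel {n : ℕ} {s : ℝ} (hs0 : 0 < s) (hs1 : s < 1) :
    Integrable (kernel s : E (n + 1) → ℝ) := by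
  have key := (integrable_fun_norm_addHaar (μ := (volume : Measure (E (n + 1))))
    (f := fun r : ℝ => min 1 r / r ^ s / r ^ (n + 1))).2 ?_
  · exact key
  rw [finrank_euclideanSpace_fin, Nat.add_sub_cancel, ← Ioc_union_Ioi_eq_Ioi zero_le_one]
  refine IntegrableOn.union ?_ ?_
  · have h1 : IntegrableOn (fun r : ℝ => r ^ (-s)) (Ioc 0 1) :=
      (intervalIntegrable_iff_integrableOn_Ioc_of_le zero_le_one).1
        (intervalIntegral.intervalIntegrable_rpow' (by linarith))
    refine h1.congr_fun (fun r hr => ?_) measurableSet_Ioc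
    have hr0 : 0 < r := hr.1
    have := Real.rpow_pos_of_pos hr0 s
    simp only [smul_eq_mul, min_eq_right hr.2, Real.rpow_neg hr0.le]
    field_simp
    ring
  · have h1 : IntegrableOn (fun r : ℝ => r ^ (-s - 1)) (Ioi 1) :=
      integrableOn_Ioi_rpow_of_lt (by linarith) one_pos
    refine h1.congr_fun (fun r hr => ?_) measurableSet_Ioi
    have hr0 : 0 < r := one_pos.trans hr
    have := Real.rpow_pos_of_pos hr0 s
    simp only [smul_eq_mul, min_eq_left (le_of_lt (mem_Ioi.1 hr)), Real.rpow_sub hr0,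
      Real.rpow_neg hr0.le, Real.rpow_one]
    field_simp
    ring

/-- Integrating first in `x`, translation decouples the variables and leaves the kernel integral
times `|S|`. It serves increments of which only one endpoint lies in a set of finite measure. -/
theorem lintegral_kernel_snd_lt_top {n : ℕ} {s : ℝ} (hs0 : 0 < s) (hs1 : s < 1)
    {S : Set (E (n + 1))} (hS : MeasurableSet S) (hfin : volume S < ⊤) (B : ℝ) :
    ∫⁻ p : E (n + 1) × E (n + 1), S.indicator 1 p.2 *
      ENNReal.ofReal (B * kernel s (p.1 - p.2)) < ⊤ := by
  have hk : Measurable fun z : E (n + 1) => ENNReal.ofReal (B * kernel s z) :=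
    ((measurable_kernel s).const_mul B).ennreal_ofReal
  have hm : Measurable fun p : E (n + 1) × E (n + 1) => S.indicator (1 : E (n + 1) → ℝ≥0∞) p.2 *
      ENNReal.ofReal (B * kernel s (p.1 - p.2)) :=
    ((measurable_one.indicator hS).comp measurable_snd).mul
      (hk.comp (measurable_fst.sub measurable_snd))
  have hfk : ∫⁻ z : E (n + 1), ENNReal.ofReal (B * kernel s z) < ⊤ := by
    refine lt_of_le_of_lt (lintegral_mono fun z => ?_)
      ((integrable_kernel (n := n) hs0 hs1).const_mul B).hasFiniteIntegral
    rw [← ofReal_norm]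
    exact ENNReal.ofReal_le_ofReal (Real.le_norm_self _)
  rw [Measure.volume_eq_prod, lintegral_prod_symm _ hm.aemeasurable]
  have : ∀ y : E (n + 1), ∫⁻ x : E (n + 1), S.indicator (1 : E (n + 1) → ℝ≥0∞) y *
      ENNReal.ofReal (B * kernel s (x - y)) =
      S.indicator 1 y * ∫⁻ z : E (n + 1), ENNReal.ofReal (B * kernel s z) := by
    intro y
    rw [lintegral_const_mul _ (show Measurable fun x : E (n + 1) =>
        ENNReal.ofReal (B * kernel s (x - y)) from hk.comp (measurable_id.sub_const y)),
      lintegral_sub_right_eq_self (fun z => ENNReal.ofReal (B * kernel s z)) y]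
  simp only [this]
  rw [lintegral_mul_const _ (measurable_one.indicator hS), lintegral_indicator_one hS]
  exact ENNReal.mul_lt_top hfin hfk

theorem lintegral_kernel_fst_lt_top {n : ℕ} {s : ℝ} (hs0 : 0 < s) (hs1 : s < 1)
    {S : Set (E (n + 1))} (hS : MeasurableSet S) (hfin : volume S < ⊤) (B : ℝ) :
    ∫⁻ p : E (n + 1) × E (n + 1), S.indicator 1 p.1 *
      ENNReal.ofReal (B * kernel s (p.1 - p.2)) < ⊤ := by
  refine lt_of_eq_of_lt ?_ (lintegral_kernel_snd_lt_top hs0 hs1 hS hfin B)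
  rw [Measure.volume_eq_prod, ← lintegral_prod_swap]
  refine lintegral_congr fun p => ?_
  rw [Prod.fst_swap, Prod.snd_swap, ← neg_sub, kernel_neg]

variable {N : ℕ} {K C s : ℝ} {G : E N → E N → ℝ → ℝ}

/-- Doubling carries the uniform bound at height 1 to height `2 ^ k > M`. -/
theorem IsAdmissible.exists_le (h : IsAdmissible K C G) {M : ℝ} (hM : 0 ≤ M) :
    ∃ B : ℝ, ∀ x y, G x y M ≤ B := by
  obtain ⟨k, hk⟩ := pow_unbounded_of_one_lt M one_lt_two
  refine ⟨K ^ k * C, fun x y => ?_⟩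
  have h1 : G x y M ≤ G x y (2 ^ k) :=
    h.mono x y (mem_Ici.2 hM) (mem_Ici.2 (by positivity)) hk.le
  have h2 : ∀ k : ℕ, G x y (2 ^ k) ≤ K ^ k * C := by
    intro k
    induction k with
    | zero => simpa using h.bound x y
    | succ k ih =>
      calc G x y (2 ^ (k + 1)) = G x y (2 * 2 ^ k) := by ring_nf
        _ ≤ K * G x y (2 ^ k) := h.double x y _ (by positivity)
        _ ≤ K * (K ^ k * C) := mul_le_mul_of_nonneg_left ih h.nonneg_const
        _ = K ^ (k + 1) * C := by ring
  exact h1.trans (h2 k)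

theorem min_div_rpow_le_one (hs0 : 0 < s) (hs1 : s < 1) {r : ℝ} (hr : 0 ≤ r) :
    min 1 r / r ^ s ≤ 1 := by
  rcases hr.eq_or_lt with rfl | hr
  · simp
  rw [div_le_one (Real.rpow_pos_of_pos hr s)]
  rcases le_total r 1 with h1 | h1
  · refine (min_le_right _ _).trans ?_
    simpa using Real.rpow_le_rpow_of_exponent_ge hr h1 hs1.le
  · exact (min_le_left _ _).trans (Real.one_le_rpow h1 hs0.le)

/-- The fractional integrand is controlled by the kernel along bounded Lipschitz increments. -/
theorem IsAdmissible.exists_fracYoung_le (h : IsAdmissible K C G) (hs0 : 0 < s) (hs1 : s < 1)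
    {M : ℝ} (hM : 0 ≤ M) : ∃ B : ℝ, ∀ (p : E N × E N) (t : ℝ), 0 ≤ t →
      t ≤ M * min 1 ‖p.1 - p.2‖ → fracYoung G s p t ≤ B * kernel s (p.1 - p.2) := by
  obtain ⟨B, hB⟩ := h.exists_le hM
  refine ⟨B, fun p t ht htM => ?_⟩
  have hm : 0 ≤ min 1 ‖p.1 - p.2‖ := le_min zero_le_one (norm_nonneg _)
  refine ((h.youngFamily_frac s).le_of_le p ht htM).trans ?_
  -- As `θ ≤ 1` and `G(x, y, 0) = 0`, convexity gives `G(θM) ≤ θ G(M)`; the factor `θ` gained here,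
  -- divided by `‖x - y‖ ^ N`, is the kernel.
  set θ := min 1 ‖p.1 - p.2‖ / ‖p.1 - p.2‖ ^ s with hθ
  have hθ0 : 0 ≤ θ := by positivity
  have h2 : G p.1 p.2 (θ * M) ≤ θ * G p.1 p.2 M := by
    have := (h.convex p.1 p.2).2 (mem_Ici.2 le_rfl) (mem_Ici.2 hM)
      (sub_nonneg.2 (min_div_rpow_le_one hs0 hs1 (norm_nonneg (p.1 - p.2)))) hθ0 (by ring)
    simpa [h.zero] using this
  have hN : 0 ≤ ‖p.1 - p.2‖ ^ N := by positivity
  calc fracYoung G s p (M * min 1 ‖p.1 - p.2‖)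
      = G p.1 p.2 (θ * M) / ‖p.1 - p.2‖ ^ N := by
        rw [fracYoung, hθ]; congr 2; ring
    _ ≤ θ * B / ‖p.1 - p.2‖ ^ N :=
        div_le_div_of_nonneg_right (h2.trans (mul_le_mul_of_nonneg_left (hB _ _) hθ0)) hN
    _ = B * kernel s (p.1 - p.2) := by rw [kernel, ← hθ]; ring

/-! ### Approximation -/

/-- `u` can be approximated in the modular sense by elements of `A`. -/
def Approximable (G : E N → E N → ℝ → ℝ) (s : ℝ) (A : Set (E N → ℝ)) (u : E N → ℝ) : Prop :=
  ∀ δ : ℝ≥0∞, 0 < δ → ∃ v ∈ A, totalModular G s (fun x => u x - v x) < δ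

theorem IsAdmissible.approximable_trans (h : IsAdmissible K C G) {A B : Set (E N → ℝ)}
    {u : E N → ℝ} (hu : Measurable u) (hA : ∀ v ∈ A, Measurable v)
    (huA : Approximable G s A u) (hAB : ∀ v ∈ A, Approximable G s B v) :
    Approximable G s B u := by
  intro δ hδ
  -- `K + 1` instead of `K`, so that one may divide by it.
  set c : ℝ≥0∞ := ENNReal.ofReal K + 1 with hc
  have hc0 : c ≠ 0 := by simp [hc]
  have hctop : c ≠ ⊤ := by simp [hc]
  obtain ⟨η, hη0, hη⟩ : ∃ η : ℝ≥0∞, 0 < η ∧ c * (η + η) ≤ δ := by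
    refine ⟨δ / c / 2, ENNReal.div_pos (ENNReal.div_pos hδ.ne' hctop).ne' (by simp), ?_⟩
    rw [ENNReal.add_halves, ENNReal.mul_div_cancel hc0 hctop]
  obtain ⟨v, hv, h1⟩ := huA η hη0
  obtain ⟨w, hw, h2⟩ := hAB v hv η hη0
  refine ⟨w, hw, ?_⟩
  calc totalModular G s (fun x => u x - w x)
      ≤ ENNReal.ofReal K * (totalModular G s (fun x => u x - v x) +
        totalModular G s (fun x => v x - w x)) := h.totalModular_sub_le hu (hA v hv)
    _ ≤ c * (totalModular G s (fun x => u x - v x) +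
        totalModular G s (fun x => v x - w x)) := mul_le_mul_left le_self_add _
    _ < c * (η + η) := (ENNReal.mul_lt_mul_iff_right hc0 hctop).2 (ENNReal.add_lt_add h1 h2)
    _ ≤ δ := hη

/-- Membership is asked only at finite modular distance from `u`: for the cutoff, that is what
yields finite modular of `v n`. -/
theorem approximable_of_tendsto {A : Set (E N → ℝ)} {u : E N → ℝ} {v : ℕ → E N → ℝ}
    (hlim : Tendsto (fun n => totalModular G s (fun x => u x - v n x)) atTop (𝓝 0))
    (hv : ∀ n, totalModular G s (fun x => u x - v n x) < ⊤ → v n ∈ A) :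
    Approximable G s A u := by
  intro δ hδ
  obtain ⟨n, h1, h2⟩ := ((hlim.eventually_lt_const hδ).and
    (hlim.eventually_lt_const ENNReal.zero_lt_top)).exists
  exact ⟨v n, hv n h2, h1⟩

theorem IsAdmissible.totalModular_ne_top_of_sub (h : IsAdmissible K C G) {u v : E N → ℝ}
    (hu : Measurable u) (hv : Measurable v) (hfu : totalModular G s u ≠ ⊤)
    (hfuv : totalModular G s (fun x => u x - v x) ≠ ⊤) : totalModular G s v ≠ ⊤ := by
  have h1 := h.totalModular_sub_le (s := s) (w := fun _ => 0) hv hu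
  have h2 : totalModular G s (fun x => v x - u x) = totalModular G s (fun x => u x - v x) := by
    have e : ∀ x y : E N, |v x - u x - (v y - u y)| = |u x - v x - (u y - v y)| := fun x y => by
      rw [← abs_neg]; ring_nf
    simp only [totalModular, modular, fracModular, abs_sub_comm (v _) (u _), e]
  simp only [sub_zero] at h1
  rw [h2] at h1
  exact ne_top_of_le_ne_top
    (ENNReal.mul_ne_top ENNReal.ofReal_ne_top (ENNReal.add_ne_top.2 ⟨hfuv, hfu⟩)) h1

/-- Measurable functions of finite modular vanishing outside `Ω`. -/
def finiteModular (G : E N → E N → ℝ → ℝ) (s : ℝ) (Ω : Set (E N)) : Set (E N → ℝ) :=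
  {u | Measurable u ∧ totalModular G s u ≠ ⊤ ∧ ∀ x ∉ Ω, u x = 0}

/-! #### Truncation -/

/-- Truncation at height `n` composed with the soft threshold `1 / (n + 1)`. -/
def clip (n : ℕ) (t : ℝ) : ℝ :=
  max (-n) (min n (max (t - 1 / (n + 1)) 0 + min (t + 1 / (n + 1)) 0))

theorem measurable_clip (n : ℕ) : Measurable (clip n) := by unfold clip; fun_prop

theorem abs_softThreshold_sub_le {ε : ℝ} (hε : 0 < ε) (r t : ℝ) :
    |(max (r - ε) 0 + min (r + ε) 0) - (max (t - ε) 0 + min (t + ε) 0)| ≤ |r - t| := by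
  grind

theorem abs_truncation_sub_le (M r t : ℝ) :
    |max (-M) (min M r) - max (-M) (min M t)| ≤ |r - t| := by
  simpa [Real.dist_eq] using ((LipschitzWith.id.const_min M).const_max (-M)).dist_le_mul r t

/-- Being 1-Lipschitz controls the fractional modular; with `clip n 0 = 0` it controls the other one
too. -/
theorem clip_sub_le (n : ℕ) (r t : ℝ) : |clip n r - clip n t| ≤ |r - t| :=
  (abs_truncation_sub_le _ _ _).trans (abs_softThreshold_sub_le (by positivity) r t)

theorem clip_eq_zero (n : ℕ) {t : ℝ} (ht : |t| ≤ 1 / (n + 1)) : clip n t = 0 := by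
  have hn : (0 : ℝ) ≤ n := n.cast_nonneg
  obtain ⟨h1, h2⟩ := abs_le.1 ht
  have e1 : max (t - 1 / (n + 1)) 0 = 0 := max_eq_right (by linarith)
  have e2 : min (t + 1 / (n + 1)) 0 = 0 := min_eq_right (by linarith)
  rw [clip, e1, e2, add_zero, min_eq_right hn, max_eq_right (by linarith)]

theorem abs_clip_le (n : ℕ) (t : ℝ) : |clip n t| ≤ n := by
  have hn : (0 : ℝ) ≤ n := n.cast_nonneg
  rw [abs_le]
  exact ⟨le_max_left _ _, max_le (by linarith) (min_le_left _ _)⟩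

theorem abs_sub_clip_le {n : ℕ} {t : ℝ} (ht : |t| ≤ n) : |t - clip n t| ≤ 1 / (n + 1) := by
  have hε : (0 : ℝ) < 1 / (n + 1) := by positivity
  obtain ⟨h1, h2⟩ := abs_le.1 ht
  set r := max (t - 1 / (n + 1)) 0 + min (t + 1 / (n + 1)) 0 with hr
  have h3 : |r| ≤ |t| := by
    have h := abs_softThreshold_sub_le hε t 0
    rwa [max_eq_right (a := 0 - 1 / ((n : ℝ) + 1)) (by linarith),
      min_eq_right (a := 0 + 1 / ((n : ℝ) + 1)) (by linarith), add_zero, sub_zero, sub_zero,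
      ← hr] at h
  obtain ⟨h4, h5⟩ := abs_le.1 (h3.trans ht)
  have h6 : clip n t = r := by rw [clip, ← hr, min_eq_right h5, max_eq_right h4]
  rw [h6, hr, abs_le]
  rcases max_cases (t - 1 / (n + 1)) 0 with ⟨e1, _⟩ | ⟨e1, _⟩ <;>
  rcases min_cases (t + 1 / (n + 1)) 0 with ⟨e2, _⟩ | ⟨e2, _⟩ <;>
  rw [e1, e2] <;> constructor <;> linarith

theorem tendsto_clip (t : ℝ) : Tendsto (fun n => clip n t) atTop (𝓝 t) := by
  rw [tendsto_iff_dist_tendsto_zero]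
  refine squeeze_zero' (Eventually.of_forall fun n => dist_nonneg) ?_
    tendsto_one_div_add_atTop_nhds_zero_nat
  filter_upwards [tendsto_natCast_atTop_atTop.eventually_ge_atTop |t|] with n hn
  rw [dist_comm, Real.dist_eq]
  exact abs_sub_clip_le hn

/-- Bounded functions whose support has finite measure. -/
def boundedFinite (N : ℕ) : Set (E N → ℝ) :=
  {u | (∃ M : ℝ, ∀ x, |u x| ≤ M) ∧ volume {x | u x ≠ 0} < ⊤}

theorem IsAdmissible.approximable_boundedFinite (h : IsAdmissible K C G) {Ω : Set (E N)}
    {u : E N → ℝ} (hu : u ∈ finiteModular G s Ω) :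
    Approximable G s (finiteModular G s Ω ∩ boundedFinite N) u := by
  obtain ⟨hum, huf, hu0⟩ := hu
  have hclip : ∀ n t, |clip n t| ≤ |t| := fun n t => by
    have := clip_sub_le n t 0
    rwa [clip_eq_zero n (t := 0) (by simp; positivity), sub_zero, sub_zero] at this
  have hvm : ∀ n, Measurable fun x => clip n (u x) := fun n => (measurable_clip n).comp hum
  have h1 : ∀ n, modular G (fun x => clip n (u x)) ≤ modular G u := fun n =>
    h.youngFamily_diag.modular_mono fun x => hclip n _
  have h2 : ∀ n, fracModular G s (fun x => clip n (u x)) ≤ fracModular G s u := fun n =>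
    (h.youngFamily_frac s).modular_mono fun p => clip_sub_le n _ _
  refine approximable_of_tendsto (v := fun n x => clip n (u x))
    (h.tendsto_totalModular_sub hum hvm (Eventually.of_forall fun x => tendsto_clip _) huf h1 h2)
    fun n _ => ⟨⟨hvm n, ne_top_of_le_ne_top huf (add_le_add (h1 n) (h2 n)), fun x hx => ?_⟩,
      ⟨n, fun x => abs_clip_le n _⟩, ?_⟩
  · dsimp only
    rw [hu0 x hx]; exact clip_eq_zero n (by simp; positivity)
  -- Chebyshev: where the clipped function is nonzero, `|u| > 1 / (n + 1)`, and there the integrand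
  -- is at least a positive constant because `G x x` does not depend on `x`.
  · have hε : (0 : ℝ) < 1 / (n + 1) := by positivity
    have hpos := h.pos 0 0 _ hε
    have hfin : ∫⁻ x : E N, ENNReal.ofReal (G x x |u x|) ≠ ⊤ := (ENNReal.add_ne_top.1 huf).1
    refine lt_of_le_of_lt (measure_mono fun x hx => ?_) (lt_of_le_of_lt
      (meas_ge_le_lintegral_div (h.youngFamily_diag.aemeasurable hum.aemeasurable)
        (ε := ENNReal.ofReal (G 0 0 (1 / (n + 1)))) (by simpa using hpos) ENNReal.ofReal_ne_top)
      (ENNReal.div_lt_top hfin (by simpa using hpos)))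
    have hx' : ¬ |u x| ≤ 1 / (n + 1) := fun hle => hx (clip_eq_zero n hle)
    refine ENNReal.ofReal_le_ofReal ?_
    rw [h.invariant.diag x (abs_nonneg _)]
    exact h.mono 0 0 (mem_Ici.2 hε.le) (mem_Ici.2 (abs_nonneg _)) (not_le.1 hx').le

/-! #### Cutoff -/

/-- A Lipschitz function vanishing on the ball of radius `j` and equal to `1` off the ball of
radius `j + 1`. -/
def farCutoff (j : ℕ) (x : E N) : ℝ := max 0 (min 1 (‖x‖ - j))

theorem farCutoff_nonneg (j : ℕ) (x : E N) : 0 ≤ farCutoff j x := le_max_left _ _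

theorem farCutoff_le_one (j : ℕ) (x : E N) : farCutoff j x ≤ 1 :=
  max_le zero_le_one (min_le_left _ _)

theorem measurable_farCutoff (j : ℕ) : Measurable (farCutoff j : E N → ℝ) := by
  unfold farCutoff; fun_prop

theorem abs_farCutoff_sub_le (j : ℕ) (x y : E N) :
    |farCutoff j x - farCutoff j y| ≤ min 1 ‖x - y‖ := by
  have h1 := abs_norm_sub_norm_le x y
  unfold farCutoff
  generalize ‖x - y‖ = d at *
  generalize ‖x‖ = a at *
  generalize ‖y‖ = b at *
  generalize (j : ℝ) = M at *
  grind

theorem farCutoff_eq_zero {j : ℕ} {x : E N} (h : ‖x‖ ≤ j) : farCutoff j x = 0 :=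
  max_eq_left ((min_le_right _ _).trans (by linarith))

theorem farCutoff_eq_one {j : ℕ} {x : E N} (h : j + 1 ≤ ‖x‖) : farCutoff j x = 1 := by
  rw [farCutoff, min_eq_left (by linarith), max_eq_right zero_le_one]

/-- Bounded functions vanishing outside a ball. -/
def boundedBall (N : ℕ) : Set (E N → ℝ) :=
  {u | (∃ M : ℝ, ∀ x, |u x| ≤ M) ∧ ∃ R : ℝ, ∀ x, R < ‖x‖ → u x = 0}

theorem IsAdmissible.approximable_boundedBall {n : ℕ} {G : E (n + 1) → E (n + 1) → ℝ → ℝ}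
    (h : IsAdmissible K C G) (hs0 : 0 < s) (hs1 : s < 1) {Ω : Set (E (n + 1))}
    {u : E (n + 1) → ℝ} (hu : u ∈ finiteModular G s Ω ∩ boundedFinite (n + 1)) :
    Approximable G s (finiteModular G s Ω ∩ boundedBall (n + 1)) u := by
  obtain ⟨⟨hum, huf, hu0⟩, ⟨M, hM⟩, hS⟩ := hu
  have hM0 : 0 ≤ M := (abs_nonneg _).trans (hM 0)
  obtain ⟨hf1, hf2⟩ := ENNReal.add_ne_top.1 huf
  set S : Set (E (n + 1)) := {x | u x ≠ 0} with hSdef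
  have hSm : MeasurableSet S := hum (measurableSet_singleton 0).compl
  set v : ℕ → E (n + 1) → ℝ := fun j x => u x - u x * farCutoff j x with hv
  have hwm : ∀ j, Measurable fun x => u x * farCutoff j x := fun j =>
    hum.mul (measurable_farCutoff j)
  have hvm : ∀ j, Measurable (v j) := fun j => hum.sub (hwm j)
  have hlim : ∀ x, Tendsto (fun j => u x * farCutoff j x) atTop (𝓝 0) := by
    intro x
    refine tendsto_const_nhds.congr' ?_
    filter_upwards [tendsto_natCast_atTop_atTop.eventually_ge_atTop ‖x‖] with j hj
    rw [farCutoff_eq_zero hj, mul_zero]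
  have hY := h.youngFamily_frac s
  obtain ⟨B, hB⟩ := h.exists_fracYoung_le hs0 hs1 hM0
  have t1 : Tendsto (fun j => modular G fun x => u x * farCutoff j x) atTop (𝓝 0) := by
    refine h.youngFamily_diag.tendsto_modular_of_dominated (fun j => (hwm j).aemeasurable)
      (Eventually.of_forall hlim) (D := fun x => ENNReal.ofReal (G x x |u x|)) hf1 fun j x => ?_
    refine ENNReal.ofReal_le_ofReal (h.youngFamily_diag.le_of_le x (abs_nonneg _) ?_)
    rw [abs_mul, abs_of_nonneg (farCutoff_nonneg j x)]
    exact mul_le_of_le_one_right (abs_nonneg _) (farCutoff_le_one j x)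
  have t2 : Tendsto (fun j => fracModular G s fun x => u x * farCutoff j x) atTop (𝓝 0) := by
    have hkey : ∫⁻ p : E (n + 1) × E (n + 1), ENNReal.ofReal K *
        (ENNReal.ofReal (fracYoung G s p |u p.1 - u p.2|) +
          S.indicator 1 p.2 * ENNReal.ofReal (B * kernel s (p.1 - p.2))) ≠ ⊤ := by
      rw [lintegral_const_mul' _ _ ENNReal.ofReal_ne_top,
        lintegral_add_left' (hY.aemeasurable (aemeasurable_diff hum))]
      exact ENNReal.mul_ne_top ENNReal.ofReal_ne_top (ENNReal.add_ne_top.2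
        ⟨hf2, (lintegral_kernel_snd_lt_top hs0 hs1 hSm hS B).ne⟩)
    refine hY.tendsto_modular_of_dominated (fun j => aemeasurable_diff (hwm j))
      (Eventually.of_forall fun p => ?_) hkey fun j p => ?_
    · simpa using (hlim p.1).sub (hlim p.2)
    -- The first term is dominated by the increment of `u`; the second is at most `M min(1, ‖x -
    -- y‖)` and vanishes unless `y ∈ S`, so the kernel dominates it.
    · have e : u p.1 * farCutoff j p.1 - u p.2 * farCutoff j p.2 =
          farCutoff j p.1 * (u p.1 - u p.2) + u p.2 * (farCutoff j p.1 - farCutoff j p.2) := by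
        ring
      rw [e]
      refine (hY.ofReal_add_le p _ _).trans ?_
      gcongr
      · refine hY.le_of_le p (abs_nonneg _) ?_
        rw [abs_mul, abs_of_nonneg (farCutoff_nonneg j p.1)]
        exact mul_le_of_le_one_left (abs_nonneg _) (farCutoff_le_one j p.1)
      · by_cases hp : p.2 ∈ S
        · rw [indicator_of_mem hp, Pi.one_apply, one_mul]
          refine ENNReal.ofReal_le_ofReal (hB p _ (abs_nonneg _) ?_)
          rw [abs_mul]
          exact mul_le_mul (hM _) (abs_farCutoff_sub_le j _ _) (abs_nonneg _) hM0
        · have : u p.2 = 0 := by simpa [hSdef] using hp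
          simp [this, hY.zero]
  have t3 := t1.add t2
  rw [add_zero] at t3
  refine approximable_of_tendsto (v := v) (t3.congr fun j => ?_) fun j hj =>
    ⟨⟨hvm j, h.totalModular_ne_top_of_sub hum (hvm j) huf hj.ne, fun x hx => ?_⟩,
      ⟨M, fun x => ?_⟩, j + 1, fun x hx => ?_⟩
  · simp only [hv, sub_sub_cancel, totalModular]
  · simp [hv, hu0 x hx]
  · have h0 := farCutoff_nonneg j x
    have h1 := farCutoff_le_one j x
    have : v j x = u x * (1 - farCutoff j x) := by simp only [hv]; ring
    rw [this, abs_mul, abs_of_nonneg (sub_nonneg.2 h1)]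
    exact (mul_le_of_le_one_right (abs_nonneg _) (by linarith)).trans (hM x)
  · simp [hv, farCutoff_eq_one hx.le]

/-! #### Translation -/

/-- Translation is continuous in `L¹`; convergence there gives convergence in measure, hence a.e.
along a subsequence. -/
theorem exists_subseq_tendsto_translate {N : ℕ} {v : E N → ℝ} (hv : Integrable v) {z : ℕ → E N}
    (hz : Tendsto z atTop (𝓝 0)) : ∃ ns : ℕ → ℕ, StrictMono ns ∧
      ∀ᵐ x, Tendsto (fun i => v (x + z (ns i))) atTop (𝓝 (v x)) := by
  set f : Lp ℝ 1 (volume : Measure (E N)) := (memLp_one_iff_integrable.2 hv).toLp v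
  have hf : f =ᵐ[volume] v := MemLp.coeFn_toLp _
  set g : C(E N, C(E N, E N)) :=
    ContinuousMap.curry ⟨fun q : E N × E N => q.2 + q.1, by fun_prop⟩ with hg
  have hgm : ∀ c, MeasurePreserving (g c) (volume : Measure (E N)) volume := fun c =>
    measurePreserving_add_right volume c
  have hT := Filter.Tendsto.compMeasurePreservingLp (tendsto_const_nhds (x := f))
    ((g.continuous.tendsto 0).comp hz) (fun k => hgm (z k)) (hgm 0) ENNReal.one_ne_top
  obtain ⟨ns, hns, hlim⟩ := (tendstoInMeasure_of_tendsto_Lp hT).exists_seq_tendsto_ae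
  refine ⟨ns, hns, ?_⟩
  have hcoe : ∀ c : E N, Lp.compMeasurePreserving (g c) (hgm c) f =ᵐ[volume]
      fun x => v (x + c) := fun c =>
    (Lp.coeFn_compMeasurePreserving f (hgm c)).trans
      ((hgm c).quasiMeasurePreserving.ae_eq_comp hf)
  filter_upwards [hlim, hcoe 0, ae_all_iff.2 fun i => hcoe (z (ns i))] with x hx h0 hi
  rw [h0, add_zero] at hx
  exact hx.congr hi

theorem IsHypograph.isOpen {n : ℕ} {Ω : Set (E (n + 1))} (hΩ : IsHypograph Ω) : IsOpen Ω := by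
  obtain ⟨ξ, R, hξ, rfl⟩ := hΩ
  exact R.toHomeomorph.isOpenMap _ (isOpen_lt (by fun_prop) (by fun_prop))

/-- A hypograph can be pushed into its interior by translations in a fixed direction. -/
theorem IsHypograph.exists_direction {n : ℕ} {Ω : Set (E (n + 1))} (hΩ : IsHypograph Ω) :
    ∃ (e : E (n + 1)) (F : Set (E (n + 1))), IsClosed F ∧ Ω ⊆ F ∧
      ∀ (r : ℝ) (x : E (n + 1)), 0 < r → x + r • e ∈ F → x ∈ Ω := by
  obtain ⟨ξ, R, hξ, rfl⟩ := hΩ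
  -- `e` is the rotated vertical unit vector and `F` the closed hypograph: lowering a point by `r >
  -- 0` decreases its height and leaves `ξ` unchanged.
  refine ⟨R.linearIsometryEquiv (EuclideanSpace.single (Fin.last n) 1),
    R '' {x | x (Fin.last n) ≤ ξ (WithLp.toLp 2 fun i : Fin n => x (Fin.castSucc i))},
    R.toHomeomorph.isClosedMap _ (isClosed_le (by fun_prop) (by fun_prop)),
    image_mono (ofPred_subset_ofPred.2 fun x hx => le_of_lt hx), ?_⟩
  rintro r x hr ⟨y, hy, hyx⟩
  have hy' : y (Fin.last n) ≤ ξ (WithLp.toLp 2 fun i : Fin n => y (Fin.castSucc i)) := hy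
  refine ⟨y - r • EuclideanSpace.single (Fin.last n) 1, ?_, ?_⟩
  · have e1 : (fun i : Fin n => (y - r • EuclideanSpace.single (Fin.last n) (1 : ℝ) :
        E (n + 1)) (Fin.castSucc i)) = fun i => y (Fin.castSucc i) := by
      funext i
      simp [(Fin.castSucc_lt_last i).ne]
    show (y - r • EuclideanSpace.single (Fin.last n) (1 : ℝ) : E (n + 1)) (Fin.last n) < _
    rw [e1]
    simp
    linarith
  · have := R.map_vadd y (-(r • EuclideanSpace.single (Fin.last n) (1 : ℝ)))
    rw [vadd_eq_add, vadd_eq_add, hyx, map_neg, map_smul, neg_add_eq_sub] at this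
    rw [this]; abel

/-- Bounded functions vanishing off a compact subset of `Ω`. -/
def boundedCompact {N : ℕ} (Ω : Set (E N)) : Set (E N → ℝ) :=
  {u | (∃ M : ℝ, ∀ x, |u x| ≤ M) ∧ ∃ k ⊆ Ω, IsCompact k ∧ ∀ x ∉ k, u x = 0}

theorem integrable_of_bounded {N : ℕ} {u : E N → ℝ} (hu : Measurable u) {M : ℝ}
    (hM : ∀ x, |u x| ≤ M) {k : Set (E N)} (hk : volume k ≠ ⊤) (h0 : ∀ x ∉ k, u x = 0) :
    Integrable u := by
  have h1 : IntegrableOn u k :=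
    Measure.integrableOn_of_bounded hk hu.aestronglyMeasurable (Eventually.of_forall hM)
  exact (integrableOn_iff_integrable_of_support_subset fun x hx => by
    by_contra hxk; exact hx (h0 x hxk)).1 h1

/-- The translates `u(x + r e)` keep both modulars and live on a compact set inside `Ω`. Only here
does the shape of `Ω` matter beyond openness. -/
theorem IsAdmissible.approximable_boundedCompact {n : ℕ} {K C s : ℝ}
    {G : E (n + 1) → E (n + 1) → ℝ → ℝ} (h : IsAdmissible K C G) {Ω : Set (E (n + 1))}
    (hΩ : IsHypograph Ω) {u : E (n + 1) → ℝ}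
    (hu : u ∈ finiteModular G s Ω ∩ boundedBall (n + 1)) :
    Approximable G s (finiteModular G s Ω ∩ boundedCompact Ω) u := by
  obtain ⟨⟨hum, huf, hu0⟩, ⟨M, hM⟩, R, hR⟩ := hu
  obtain ⟨e, F, hF, hΩF, hpush⟩ := hΩ.exists_direction
  have huR : ∀ x ∉ Metric.closedBall (0 : E (n + 1)) R, u x = 0 := fun x hx =>
    hR x (by simpa using hx)
  have hui : Integrable u := integrable_of_bounded hum hM measure_closedBall_lt_top.ne huR
  have hz : Tendsto (fun j : ℕ => (1 / ((j : ℝ) + 1)) • e) atTop (𝓝 0) := by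
    simpa using (tendsto_one_div_add_atTop_nhds_zero_nat (𝕜 := ℝ)).smul_const e
  obtain ⟨ns, -, hlim⟩ := exists_subseq_tendsto_translate hui hz
  have hvm : ∀ c, Measurable fun x => u (x + c) := fun c => hum.comp (measurable_add_const c)
  refine approximable_of_tendsto
    (h.tendsto_totalModular_sub hum (fun i => hvm _) hlim huf
      (fun i => (h.invariant.modular_translate u _).le)
      (fun i => (h.invariant.fracModular_translate u _).le)) fun i _ => ?_
  set r : ℝ := 1 / ((ns i : ℝ) + 1) with hr
  have hr0 : 0 < r := by positivity
  have hk : ∀ x ∉ (fun x => x + r • e) ⁻¹' (F ∩ Metric.closedBall 0 R), u (x + r • e) = 0 := by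
    intro x hx
    by_contra hne
    refine hx ⟨hΩF ?_, ?_⟩
    · by_contra hxΩ; exact hne (hu0 _ hxΩ)
    · by_contra hxR; exact hne (huR _ hxR)
  have hkΩ : (fun x => x + r • e) ⁻¹' (F ∩ Metric.closedBall 0 R) ⊆ Ω :=
    fun x hx => hpush r x hr0 hx.1
  refine ⟨⟨hvm _, ?_, fun x hx => hk x fun hxk => hx (hkΩ hxk)⟩, ⟨M, fun x => hM _⟩, _, hkΩ,
    ?_, hk⟩
  · rw [totalModular, h.invariant.modular_translate, h.invariant.fracModular_translate]
    exact huf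
  · exact (Homeomorph.addRight (r • e)).isCompact_preimage.2
      ((isCompact_closedBall 0 R).inter_left hF)

/-! #### Mollification -/

/-- The probability measure with density a normalized bump. -/
def bumpMeasure {N : ℕ} (ρ : ContDiffBump (0 : E N)) : Measure (E N) :=
  volume.withDensity fun y => ENNReal.ofReal (ρ.normed volume y)

instance {N : ℕ} (ρ : ContDiffBump (0 : E N)) : IsProbabilityMeasure (bumpMeasure ρ) := by
  refine ⟨?_⟩
  rw [bumpMeasure, withDensity_apply _ MeasurableSet.univ, Measure.restrict_univ,
    ← ofReal_integral_eq_lintegral_ofReal ρ.integrable_normed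
      (Eventually.of_forall ρ.nonneg_normed), ρ.integral_normed, ENNReal.ofReal_one]

/-- Exhibits mollification as a probability average of translates, the form Jensen's inequality
needs. -/
theorem convolution_eq_integral_bumpMeasure {N : ℕ} (ρ : ContDiffBump (0 : E N)) (u : E N → ℝ)
    (x : E N) : (convolution (ρ.normed volume) u (ContinuousLinearMap.lsmul ℝ ℝ) volume) x =
      ∫ y, u (x - y) ∂bumpMeasure ρ := by
  rw [bumpMeasure, integral_withDensity_eq_integral_toReal_smul
    ρ.continuous_normed.measurable.ennreal_ofReal (Eventually.of_forall fun y => by simp)]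
  refine integral_congr_ae (Eventually.of_forall fun y => ?_)
  simp [ENNReal.toReal_ofReal (ρ.nonneg_normed y)]

theorem IsAdmissible.approximable_testFunctions {N : ℕ} {K C s : ℝ}
    {G : E N → E N → ℝ → ℝ} (h : IsAdmissible K C G) {Ω : Set (E N)} (hΩ : IsOpen Ω)
    {u : E N → ℝ} (hu : u ∈ finiteModular G s Ω ∩ boundedCompact Ω) :
    Approximable G s (testFunctions Ω) u := by
  obtain ⟨⟨hum, huf, -⟩, ⟨M, hM⟩, k, hkΩ, hk, hu0⟩ := hu
  obtain ⟨δ, hδ, hδΩ⟩ := hk.exists_cthickening_subset_open hΩ hkΩ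
  have hui : Integrable u := integrable_of_bounded hum hM hk.measure_lt_top.ne hu0
  -- Outer radii at most `δ` keep supports in the thickening of `k`; the fixed ratio 2 of the radii
  -- is what a.e. convergence requires.
  set ρ : ℕ → ContDiffBump (0 : E N) := fun j =>
    ⟨δ / (j + 1) / 2, δ / (j + 1), by positivity, half_lt_self (by positivity)⟩ with hρ
  have hρlim : Tendsto (fun j => (ρ j).rOut) atTop (𝓝 0) := by
    simpa [hρ, div_eq_mul_inv] using
      (tendsto_one_div_add_atTop_nhds_zero_nat (𝕜 := ℝ)).const_mul δ
  have hρle : ∀ j, (ρ j).rOut ≤ δ := fun j =>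
    div_le_self hδ.le (by have : (0 : ℝ) ≤ j := j.cast_nonneg; linarith)
  set φ : ℕ → E N → ℝ := fun j =>
    convolution ((ρ j).normed volume) u (ContinuousLinearMap.lsmul ℝ ℝ) volume with hφ
  have hφe : ∀ j, φ j = fun x => ∫ y, u (x - y) ∂bumpMeasure (ρ j) := fun j =>
    funext fun x => convolution_eq_integral_bumpMeasure _ _ _
  have hlim : ∀ᵐ x, Tendsto (fun j => φ j x) atTop (𝓝 (u x)) :=
    ContDiffBump.ae_convolution_tendsto_right_of_locallyIntegrable (K := 2) hρlim
      (Eventually.of_forall fun j => by simp only [hρ]; linarith) hui.locallyIntegrable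
  have hsmooth : ∀ j, ContDiff ℝ ∞ (φ j) := fun j =>
    (ρ j).hasCompactSupport_normed.contDiff_convolution_left _ (ρ j).contDiff_normed
      hui.locallyIntegrable
  have hi : ∀ j x, Integrable (fun y => u (x - y)) (bumpMeasure (ρ j)) := fun j x =>
    Integrable.of_bound (hum.comp (measurable_const.sub measurable_id)).aestronglyMeasurable M
      (Eventually.of_forall fun y => hM _)
  have h1 : ∀ j, modular G (φ j) ≤ modular G u := by
    intro j
    rw [hφe j]
    refine h.youngFamily_diag.modular_integral_le (F := fun x y => u (x - y))
      (hum.comp (measurable_fst.sub measurable_snd)) (hi j) fun y => ?_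
    have := (h.invariant.modular_translate u (-y)).le
    simp only [← sub_eq_add_neg] at this
    exact this
  have h2 : ∀ j, fracModular G s (φ j) ≤ fracModular G s u := by
    intro j
    have := (h.youngFamily_frac s).modular_integral_le (ν := bumpMeasure (ρ j))
      (F := fun (p : E N × E N) y => u (p.1 - y) - u (p.2 - y)) (c := fracModular G s u)
      ((hum.comp ((measurable_fst.comp measurable_fst).sub measurable_snd)).sub
        (hum.comp ((measurable_snd.comp measurable_fst).sub measurable_snd)))
      (fun p => (hi j p.1).sub (hi j p.2)) fun y => by
        have := (h.invariant.fracModular_translate (s := s) u (-y)).le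
        simp only [← sub_eq_add_neg] at this
        exact this
    refine le_of_eq_of_le ?_ this
    rw [hφe j, fracModular_eq_youngModular]
    congr 1
    funext p
    exact (integral_sub (hi j p.1) (hi j p.2)).symm
  refine approximable_of_tendsto (h.tendsto_totalModular_sub hum
    (fun j => (hsmooth j).continuous.measurable) hlim huf h1 h2) fun j _ => ?_
  have hsupp : tsupport (φ j) ⊆ Metric.cthickening δ k := by
    refine closure_minimal (fun x hx => ?_) Metric.isClosed_cthickening
    by_contra hxk
    refine hx ?_
    rw [hφ]
    simp only [convolution]
    refine integral_eq_zero_of_ae (Eventually.of_forall fun y => ?_)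
    by_cases hy : y ∈ Function.support ((ρ j).normed volume)
    · have : u (x - y) = 0 := by
        refine hu0 _ fun hxy => hxk ?_
        rw [ContDiffBump.support_normed_eq, mem_ball_zero_iff] at hy
        refine Metric.mem_cthickening_of_dist_le x (x - y) δ k hxy ?_
        rw [dist_eq_norm, sub_sub_cancel]
        exact hy.le.trans (hρle j)
      simp [this]
    · simp [Function.notMem_support.1 hy]
  exact ⟨hsmooth j, hk.cthickening.of_isClosed_subset (isClosed_tsupport _) hsupp,
    hsupp.trans hδΩ⟩

/-! ### Test functions belong to the space -/

theorem IsAdmissible.testFunctions_subset {n : ℕ} {K C s : ℝ}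
    {G : E (n + 1) → E (n + 1) → ℝ → ℝ} (h : IsAdmissible K C G) (hs0 : 0 < s) (hs1 : s < 1)
    (Ω : Set (E (n + 1))) : testFunctions Ω ⊆ fracSobolevZero G s Ω := by
  rintro φ ⟨hφ, hc, hΩ⟩
  have hm : Measurable φ := hφ.continuous.measurable
  obtain ⟨L, hL⟩ := hφ.lipschitzWith_of_hasCompactSupport hc (by simp)
  obtain ⟨M₀, hM₀⟩ := hc.exists_bound_of_continuous hφ.continuous
  have hM₀0 : 0 ≤ M₀ := (norm_nonneg _).trans (hM₀ 0)
  set S : Set (E (n + 1)) := tsupport φ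
  have hSm : MeasurableSet S := (isClosed_tsupport φ).measurableSet
  have hS : volume S < ⊤ := hc.isCompact.measure_lt_top
  have h0 : ∀ x ∉ S, φ x = 0 := fun x hx => image_eq_zero_of_notMem_tsupport hx
  -- `L` serves near points, `2 * M₀` distant ones. Increments vanish when both points miss `S`, so
  -- two kernel integrals suffice.
  set M : ℝ := max L (2 * M₀) with hMdef
  have hM : 0 ≤ M := le_max_of_le_left L.2
  have hinc : ∀ p : E (n + 1) × E (n + 1), |φ p.1 - φ p.2| ≤ M * min 1 ‖p.1 - p.2‖ := by
    intro p
    rw [mul_min_of_nonneg _ _ hM, mul_one]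
    refine le_min ?_ ?_
    · have := abs_sub (φ p.1) (φ p.2)
      have h1 := hM₀ p.1
      have h2 := hM₀ p.2
      rw [Real.norm_eq_abs] at h1 h2
      exact le_trans (by linarith) (le_max_right _ _)
    · have := hL.dist_le_mul p.1 p.2
      rw [Real.dist_eq, dist_eq_norm] at this
      exact this.trans (mul_le_mul_of_nonneg_right (le_max_left _ _) (norm_nonneg _))
  refine ⟨⟨⟨hm.aemeasurable, 1, one_pos, ?_⟩, 1, one_pos, ?_⟩,
    Eventually.of_forall fun x hx => h0 x fun hxS => hx (hΩ hxS)⟩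
  · simp only [one_mul]
    calc modular G φ ≤ ∫⁻ x, S.indicator (fun _ => ENNReal.ofReal (G 0 0 M₀)) x := by
          refine lintegral_mono fun x => ?_
          by_cases hx : x ∈ S
          · rw [indicator_of_mem hx, h.invariant.diag x (abs_nonneg _)]
            exact ENNReal.ofReal_le_ofReal
              (h.mono 0 0 (mem_Ici.2 (abs_nonneg _)) (mem_Ici.2 hM₀0) (hM₀ x))
          · simp [h0 x hx, h.zero]
      _ = ENNReal.ofReal (G 0 0 M₀) * volume S := lintegral_indicator_const hSm _
      _ < ⊤ := ENNReal.mul_lt_top ENNReal.ofReal_lt_top hS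
  · simp only [one_mul]
    obtain ⟨B, hB⟩ := h.exists_fracYoung_le hs0 hs1 hM
    have hmeas : Measurable fun p : E (n + 1) × E (n + 1) =>
        S.indicator (1 : E (n + 1) → ℝ≥0∞) p.1 * ENNReal.ofReal (B * kernel s (p.1 - p.2)) :=
      ((measurable_one.indicator hSm).comp measurable_fst).mul
        (((measurable_kernel s).const_mul B).ennreal_ofReal.comp
          (measurable_fst.sub measurable_snd))
    refine lt_of_le_of_lt ?_ (ENNReal.add_lt_top.2
      ⟨lintegral_kernel_fst_lt_top hs0 hs1 hSm hS B, lintegral_kernel_snd_lt_top hs0 hs1 hSm hS B⟩)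
    rw [← lintegral_add_left hmeas]
    refine lintegral_mono fun p => ?_
    show ENNReal.ofReal (fracYoung G s p |φ p.1 - φ p.2|) ≤ _
    have hle := ENNReal.ofReal_le_ofReal (hB p _ (abs_nonneg _) (hinc p))
    by_cases hp1 : p.1 ∈ S
    · refine le_add_of_le_of_nonneg ?_ zero_le
      simpa [indicator_of_mem hp1] using hle
    · by_cases hp2 : p.2 ∈ S
      · refine le_add_of_nonneg_of_le zero_le ?_
        simpa [indicator_of_mem hp2] using hle
      · simp [h0 _ hp1, h0 _ hp2, (h.youngFamily_frac s).zero]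

/-! ### Borel representatives and the chain of approximations -/

theorem IsAdmissible.exists_finiteModular_ae_eq {N : ℕ} {K C s : ℝ}
    {G : E N → E N → ℝ → ℝ} (h : IsAdmissible K C G) {Ω : Set (E N)} (hΩ : IsOpen Ω)
    {u : E N → ℝ} (hu : u ∈ fracSobolevZero G s Ω) :
    ∃ v ∈ finiteModular G s Ω, u =ᵐ[volume] v := by
  obtain ⟨⟨⟨hum, r₁, hr₁, hf₁⟩, r₂, hr₂, hf₂⟩, h0⟩ := hu
  have hae : u =ᵐ[volume] Ω.indicator (hum.mk u) := by
    filter_upwards [h0, hum.ae_eq_mk] with x hx hx'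
    by_cases hxΩ : x ∈ Ω
    · rw [indicator_of_mem hxΩ, hx']
    · rw [indicator_of_notMem hxΩ, hx hxΩ]
  refine ⟨_, ⟨hum.measurable_mk.indicator hΩ.measurableSet, ?_, fun x hx =>
    indicator_of_notMem hx _⟩, hae⟩
  rw [← totalModular_congr_ae hae]
  -- Membership gives finite modulars only for some multiples of `u`; doubling undoes the scaling.
  obtain ⟨C₁, -, h1⟩ := h.youngFamily_diag.exists_modular_mul_le r₁⁻¹
  obtain ⟨C₂, -, h2⟩ := (h.youngFamily_frac s).exists_modular_mul_le r₂⁻¹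
  refine ENNReal.add_ne_top.2 ⟨?_, ?_⟩
  · refine ne_top_of_le_ne_top (ENNReal.mul_ne_top ENNReal.ofReal_ne_top hf₁.ne)
      (le_of_eq_of_le ?_ (h1 fun x => r₁ * u x))
    rw [modular_eq_youngModular]
    congr 1; funext x; field_simp
  · refine ne_top_of_le_ne_top (ENNReal.mul_ne_top ENNReal.ofReal_ne_top hf₂.ne)
      (le_of_eq_of_le ?_ (h2 fun p => r₂ * u p.1 - r₂ * u p.2))
    rw [fracModular_eq_youngModular]
    congr 1; funext p; field_simp

/-- The order is forced: the cutoff needs boundedness and finite measure, the push needs a ball to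
reach compactness, and mollification needs room inside `Ω`. -/
theorem IsAdmissible.approximable_of_mem_fracSobolevZero {n : ℕ} {K C s : ℝ}
    {G : E (n + 1) → E (n + 1) → ℝ → ℝ} (h : IsAdmissible K C G) (hs0 : 0 < s) (hs1 : s < 1)
    {Ω : Set (E (n + 1))} (hΩ : IsHypograph Ω) {u : E (n + 1) → ℝ}
    (hu : u ∈ fracSobolevZero G s Ω) : Approximable G s (testFunctions Ω) u := by
  obtain ⟨v, hv, huv⟩ := h.exists_finiteModular_ae_eq hΩ.isOpen hu
  have key : Approximable G s (testFunctions Ω) v := by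
    refine h.approximable_trans hv.1 (fun w hw => hw.1.1) (h.approximable_boundedFinite hv)
      fun w hw => ?_
    refine h.approximable_trans hw.1.1 (fun w hw => hw.1.1)
      (h.approximable_boundedBall hs0 hs1 hw) fun w hw => ?_
    exact h.approximable_trans hw.1.1 (fun w hw => hw.1.1)
      (h.approximable_boundedCompact hΩ hw) fun w hw => h.approximable_testFunctions hΩ.isOpen hw
  intro δ hδ
  obtain ⟨φ, hφ, hlt⟩ := key δ hδ
  refine ⟨φ, hφ, ?_⟩
  rwa [totalModular_congr_ae (v := fun x => v x - φ x)]
  filter_upwards [huv] with x hx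
  rw [hx]

end FracMusielak

end

theorem theorem1 (n : ℕ) (s : ℝ) (hs0 : 0 < s) (hs1 : s < 1)
    (Ω : Set (FracMusielak.E (n + 1))) (hΩ : FracMusielak.IsHypograph Ω)
    (a : FracMusielak.E (n + 1) → FracMusielak.E (n + 1) → ℝ → ℝ)
    (ha : ∀ x y : FracMusielak.E (n + 1), ∀ t : ℝ, 0 < t → 0 ≤ a x y t)
    (hG : FracMusielak.IsCaratheodory (FracMusielak.GFun a))
    (hg1 : FracMusielak.CondG1 a) (hg2 : FracMusielak.CondG2 a)
    (hg3 : FracMusielak.CondG3 a) (hg4 : FracMusielak.CondG4 a)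
    (hH1 : FracMusielak.CondH1 (FracMusielak.GFun a))
    (hH2 : FracMusielak.CondH2 (FracMusielak.GFun a))
    (hBf : FracMusielak.CondBf (FracMusielak.GFun a)) :
    FracMusielak.testFunctions Ω ⊆ FracMusielak.fracSobolevZero (FracMusielak.GFun a) s Ω ∧
      ∀ u ∈ FracMusielak.fracSobolevZero (FracMusielak.GFun a) s Ω, ∀ ε : ℝ, 0 < ε →
        ∃ φ ∈ FracMusielak.testFunctions Ω,
          FracMusielak.sobolevNorm (FracMusielak.GFun a) s (fun x => u x - φ x)
            < ENNReal.ofReal ε := by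
  obtain ⟨K, C, h⟩ := FracMusielak.isAdmissible_GFun ha hG hg2 hg3 hg4 hH2 hBf
  refine ⟨h.testFunctions_subset hs0 hs1 Ω, fun u hu ε hε => ?_⟩
  obtain ⟨δ, hδ, hlt⟩ := h.exists_sobolevNorm_lt s hε
  obtain ⟨φ, hφ, hφδ⟩ := h.approximable_of_mem_fracSobolevZero hs0 hs1 hΩ hu δ hδ
  exact ⟨φ, hφ, hlt _ hφδ⟩
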